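/- **Conventions.** A *locally conformally Kähler* (lcK) manifold $(M,g,J)$ with Lee form $\theta$ is a smooth manifold of real dimension $>2$ with an integrable complex structure $J$ and a Hermitian metric $g$ such that, writing $\omega=g(J\cdot,\cdot)$, every point has a neighbourhood $U$ with a smooth $f_U:U\to\mathbb R$ for which $e^{-f_U}\omega$ is closed and $\theta|_U=df_U$. It is *Vaisman* if $\theta$ is not exact, is parallel for the Levi-Civita connection of $g$, and has unit length. For a smooth action of a Lie group $G$ with Lie algebra $\mathfrak g$, $\overline X$ denotes the fundamental vector field of $X\in\mathfrak g$. A map $\mu:M\to\mathfrak g^*$ with smooth components $\mu^X$ is a *twisted moment map* if $d\mu^X-\mu^X\theta=\omega(\overline X,\cdot)$ for all $X\in\mathfrak g$; the action is *twisted Hamiltonian* if such a $\mu$ exists. The *minimal covering* $p:\hat M\to M$ is the connected Galois covering with $p^*\theta=dh$ for a smooth $h:\hat M\to\mathbb R$ such that the homomorphism $\gamma\mapsto h\circ\gamma-h\in\mathbb R$ on its deck transformation group is injective. Given such an $h$, the *associated Sasakian manifold* is the hypersurface $S=h^{-1}(0)\subset\hat M$; its contact form is $\eta=-d^ch|_S$,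 where $d^ch=dh\circ\hat J$ and $\hat J$ is the lift of $J$ to $\hat M$ (equivalently, $\eta$ is dual, in the metric induced by $p^*g$, to the Reeb field, the lift of $J\theta^\sharp$). An action of $G$ on $S$ is *induced* by an action on $M$ if it is the restriction to $S$ of a smooth action of $G$ on $\hat M$ lifting the given one. For a smooth action of $G$ on $S$ preserving $\eta$, the *contact moment map* is $\Phi:S\to\mathfrak g^*$, $\Phi(s)(X)=\eta_s(\overline X_s)$, where $\overline X$ is the fundamental field on $S$. **Proposition.** Let $(M,g,J)$ be a connected Vaisman manifold with Lee form $\theta$ such that $(M,g)$ is complete. Let a compact connected Lie group $G$ act smoothly on $M$ by holomorphic isometries, and suppose the action is twisted Hamiltonian with twisted moment map $\mu:M\to\mathfrak g^*$. Let $p:\hat M\to M$ be the minimal covering, $h$ a primitive of $p^*\theta$, and $S=h^{-1}(0)$ the associated Sasakian manifold with contact form $\eta$. Then $S$ carries a smooth induced action of $G$, every induced action preserves $\eta$, and its contact moment map $\Phi:S\to\mathfrak g^*$ satisfies $$\Phi(S)=\mu(M).$$ -/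

import Mathlib

open scoped Manifold ContDiff Bundle

namespace VaismanMoment

noncomputable section

section Geometry

variable {E : Type*} [NormedAddCommGroup E] [NormedSpace ℝ E]
  {M : Type*} [TopologicalSpace M] [ChartedSpace E M]

/-- A vector field on `M`. -/
abbrev VField (E : Type*) [NormedAddCommGroup E] [NormedSpace ℝ E]
    (M : Type*) [TopologicalSpace M] [ChartedSpace E M] : Type _ :=
  (x : M) → TangentSpace 𝓘(ℝ, E) x

/-- A `1`-form on `M` (a family of covectors). -/
abbrev OneForm (E : Type*) [NormedAddCommGroup E] [NormedSpace ℝ E]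
    (M : Type*) [TopologicalSpace M] [ChartedSpace E M] : Type _ :=
  (x : M) → TangentSpace 𝓘(ℝ, E) x →L[ℝ] ℝ

/-- A field of endomorphisms of the tangent spaces of `M`. -/
abbrev EndField (E : Type*) [NormedAddCommGroup E] [NormedSpace ℝ E]
    (M : Type*) [TopologicalSpace M] [ChartedSpace E M] : Type _ :=
  (x : M) → TangentSpace 𝓘(ℝ, E) x →L[ℝ] TangentSpace 𝓘(ℝ, E) x

/-- Differentiability at a point of a vector field, as a section of the tangent bundle. -/
def VField.DiffAt [IsManifold 𝓘(ℝ, E) ∞ M] (X : VField E M) (x : M) : Prop :=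
  MDifferentiableAt 𝓘(ℝ, E) (𝓘(ℝ, E).prod 𝓘(ℝ, E))
    (fun y => (⟨y, X y⟩ : TangentBundle 𝓘(ℝ, E) M)) x

/-- The value at `x` of `(dβ)(X, Y, Z)` for a `2`-form `β` and vector fields `X`, `Y`, `Z`:
`X β(Y, Z) - Y β(X, Z) + Z β(X, Y) - β([X, Y], Z) + β([X, Z], Y) - β([Y, Z], X)`. -/
def extDerivTwoForm
    (β : (x : M) → TangentSpace 𝓘(ℝ, E) x → TangentSpace 𝓘(ℝ, E) x → ℝ)
    (X Y Z : VField E M) (x : M) : ℝ :=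
  mvfderiv 𝓘(ℝ, E) (fun y => β y (Y y) (Z y)) x (X x)
    - mvfderiv 𝓘(ℝ, E) (fun y => β y (X y) (Z y)) x (Y x)
    + mvfderiv 𝓘(ℝ, E) (fun y => β y (X y) (Y y)) x (Z x)
    - β x (VectorField.mlieBracket 𝓘(ℝ, E) X Y x) (Z x)
    + β x (VectorField.mlieBracket 𝓘(ℝ, E) X Z x) (Y x)
    - β x (VectorField.mlieBracket 𝓘(ℝ, E) Y Z x) (X x)

/-- The `2`-form `β` is closed on the open set `U`. -/
def IsClosedTwoFormOn [IsManifold 𝓘(ℝ, E) ∞ M]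
    (β : (x : M) → TangentSpace 𝓘(ℝ, E) x → TangentSpace 𝓘(ℝ, E) x → ℝ) (U : Set M) : Prop :=
  ∀ x ∈ U, ∀ X Y Z : VField E M, X.DiffAt x → Y.DiffAt x → Z.DiffAt x →
    extDerivTwoForm β X Y Z x = 0

/-- The field of endomorphisms `J` is a smooth section of the endomorphism bundle. -/
def EndField.IsSmooth [IsManifold 𝓘(ℝ, E) ∞ M] (J : EndField E M) : Prop :=
  ContMDiff 𝓘(ℝ, E) (𝓘(ℝ, E).prod 𝓘(ℝ, E →L[ℝ] E)) ∞
    (fun x => Bundle.TotalSpace.mk' (E →L[ℝ] E)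
      (E := fun x : M => TangentSpace 𝓘(ℝ, E) x →L[ℝ] TangentSpace 𝓘(ℝ, E) x) x (J x))

/-- `J` is an integrable almost complex structure: it is smooth, squares to `-1`, and its
Nijenhuis tensor vanishes. -/
structure IsComplexStructure [IsManifold 𝓘(ℝ, E) ∞ M] (J : EndField E M) : Prop where
  smooth : J.IsSmooth
  sq_eq_neg : ∀ x v, J x (J x v) = -v
  nijenhuis : ∀ (x : M) (X Y : VField E M), X.DiffAt x → Y.DiffAt x →
    VectorField.mlieBracket 𝓘(ℝ, E) (fun y => J y (X y)) (fun y => J y (Y y)) x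
      - J x (VectorField.mlieBracket 𝓘(ℝ, E) (fun y => J y (X y)) Y x)
      - J x (VectorField.mlieBracket 𝓘(ℝ, E) X (fun y => J y (Y y)) x)
      - VectorField.mlieBracket 𝓘(ℝ, E) X Y x = 0

/-- The `1`-form `θ` is the differential of a smooth function on `M`. -/
def IsExactOneForm (θ : OneForm E M) : Prop :=
  ∃ f : M → ℝ, ContMDiff 𝓘(ℝ, E) 𝓘(ℝ, ℝ) ∞ f ∧ ∀ x, mvfderiv 𝓘(ℝ, E) f x = θ x

end Geometry

section Metric

variable {E : Type*} [NormedAddCommGroup E] [NormedSpace ℝ E]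
  {M : Type*} [TopologicalSpace M] [ChartedSpace E M] [IsManifold 𝓘(ℝ, E) ∞ M]
  [Bundle.RiemannianBundle (fun x : M => TangentSpace 𝓘(ℝ, E) x)]

/-- The fundamental form `ω = g(J ·, ·)` of a Hermitian metric. -/
def fundamentalForm (J : EndField E M) (x : M) (u v : TangentSpace 𝓘(ℝ, E) x) : ℝ :=
  inner ℝ (J x u) v

/-- The covariant derivative `D` on the tangent bundle is the Levi-Civita connection: it is
torsion free and compatible with the Riemannian metric. Here `D Y x (X x)` is `(D_X Y)(x)`. -/
structure IsLeviCivita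
    (D : CovariantDerivative 𝓘(ℝ, E) E (fun x : M => TangentSpace 𝓘(ℝ, E) x)) : Prop where
  torsionFree : ∀ (x : M) (X Y : VField E M), X.DiffAt x → Y.DiffAt x →
    D Y x (X x) - D X x (Y x) = VectorField.mlieBracket 𝓘(ℝ, E) X Y x
  metric : ∀ (x : M) (v : TangentSpace 𝓘(ℝ, E) x) (Y Z : VField E M), Y.DiffAt x → Z.DiffAt x →
    mvfderiv 𝓘(ℝ, E) (fun y => inner ℝ (Y y) (Z y)) x v
      = inner ℝ (D Y x v) (Z x) + inner ℝ (Y x) (D Z x v)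

/-- The `1`-form `θ` is parallel for the Levi-Civita connection. -/
def IsParallelOneForm (θ : OneForm E M) : Prop :=
  ∃ D : CovariantDerivative 𝓘(ℝ, E) E (fun x : M => TangentSpace 𝓘(ℝ, E) x),
    IsLeviCivita D ∧
    ∀ (x : M) (v : TangentSpace 𝓘(ℝ, E) x) (Y : VField E M), Y.DiffAt x →
      mvfderiv 𝓘(ℝ, E) (fun y => θ y (Y y)) x v - θ x (D Y x v) = 0

/-- `(M, g, J)` is locally conformally Kähler with Lee form `θ`: the metric `g` is Hermitian for
the complex structure `J`, the real dimension is greater than two, and near each point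
there is a smooth function `f` such that `e^{-f} ω` is closed and `θ = df`. -/
structure IsLCK (J : EndField E M) (θ : OneForm E M) : Prop where
  two_lt_dim : 2 < Module.finrank ℝ E
  complex : IsComplexStructure J
  hermitian : ∀ (x : M) (u v : TangentSpace 𝓘(ℝ, E) x), inner ℝ (J x u) (J x v) = inner ℝ u v
  locallyConformal : ∀ x : M, ∃ U : Set M, IsOpen U ∧ x ∈ U ∧ ∃ f : M → ℝ,
    ContMDiffOn 𝓘(ℝ, E) 𝓘(ℝ, ℝ) ∞ f U ∧
    (∀ y ∈ U, mvfderiv 𝓘(ℝ, E) f y = θ y) ∧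
    IsClosedTwoFormOn (fun y u v => Real.exp (-f y) * fundamentalForm J y u v) U

/-- `(M, g, J)` is a Vaisman manifold with Lee form `θ`: it is strictly locally conformally Kähler
and `θ` is parallel, normalized to have unit length. -/
structure IsVaisman (J : EndField E M) (θ : OneForm E M) : Prop extends IsLCK J θ where
  strict : ¬ IsExactOneForm θ
  parallel : IsParallelOneForm θ
  unit_length : ∀ x : M, ‖θ x‖ = 1

end Metric

section Actions

variable {F : Type*} [NormedAddCommGroup F] [NormedSpace ℝ F]
  {G : Type*} [TopologicalSpace G] [ChartedSpace F G] [Group G]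
  {E : Type*} [NormedAddCommGroup E] [NormedSpace ℝ E]
  {M : Type*} [TopologicalSpace M] [ChartedSpace E M]

/-- A smooth left action of the Lie group `G` on the manifold `M`. -/
structure SmoothAction (F : Type*) [NormedAddCommGroup F] [NormedSpace ℝ F]
    (G : Type*) [TopologicalSpace G] [ChartedSpace F G] [Group G]
    (E : Type*) [NormedAddCommGroup E] [NormedSpace ℝ E]
    (M : Type*) [TopologicalSpace M] [ChartedSpace E M] where
  act : G → M → M
  one_act : ∀ x, act 1 x = x
  mul_act : ∀ a b x, act (a * b) x = act a (act b x)
  smooth : ContMDiff (𝓘(ℝ, F).prod 𝓘(ℝ, E)) 𝓘(ℝ, E) ∞ (fun q : G × M => act q.1 q.2)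

/-- The dual `𝔤*` of the Lie algebra of `G`. -/
abbrev LieDual (F : Type*) [NormedAddCommGroup F] [NormedSpace ℝ F]
    (G : Type*) [TopologicalSpace G] [ChartedSpace F G] [Group G] : Type _ :=
  GroupLieAlgebra 𝓘(ℝ, F) G →L[ℝ] ℝ

/-- The infinitesimal action at `x`, sending `X ∈ 𝔤` to the value at `x` of the fundamental vector
field of `X`: the differential at `1` of the orbit map `a ↦ a • x`. -/
def SmoothAction.fundamental (A : SmoothAction F G E M) (x : M) :
    GroupLieAlgebra 𝓘(ℝ, F) G →L[ℝ] TangentSpace 𝓘(ℝ, E) x :=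
  mfderiv 𝓘(ℝ, F) 𝓘(ℝ, E) (fun a : G => A.act a x) 1

/-- The group acts by automorphisms of the Vaisman structure, that is, by holomorphic
isometries. -/
structure SmoothAction.ByVaismanAutomorphisms [IsManifold 𝓘(ℝ, E) ∞ M]
    [Bundle.RiemannianBundle (fun x : M => TangentSpace 𝓘(ℝ, E) x)]
    (A : SmoothAction F G E M) (J : EndField E M) : Prop where
  isometric : ∀ (a : G) (x : M) (u v : TangentSpace 𝓘(ℝ, E) x),
    inner ℝ (mfderiv 𝓘(ℝ, E) 𝓘(ℝ, E) (A.act a) x u) (mfderiv 𝓘(ℝ, E) 𝓘(ℝ, E) (A.act a) x v)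
      = inner ℝ u v
  holomorphic : ∀ (a : G) (x : M) (v : TangentSpace 𝓘(ℝ, E) x),
    mfderiv 𝓘(ℝ, E) 𝓘(ℝ, E) (A.act a) x (J x v)
      = J (A.act a x) (mfderiv 𝓘(ℝ, E) 𝓘(ℝ, E) (A.act a) x v)

/-- `μ : M → 𝔤*` is a twisted moment map: for each `X ∈ 𝔤` the component `μ^X` is smooth and
`d μ^X - μ^X θ = ω(X̄, ·)`, where `X̄` is the fundamental vector field of `X`. -/
structure IsTwistedMomentMap [IsManifold 𝓘(ℝ, E) ∞ M]
    [Bundle.RiemannianBundle (fun x : M => TangentSpace 𝓘(ℝ, E) x)]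
    (J : EndField E M) (θ : OneForm E M) (A : SmoothAction F G E M) (μ : M → LieDual F G) :
    Prop where
  smooth : ∀ X : GroupLieAlgebra 𝓘(ℝ, F) G, ContMDiff 𝓘(ℝ, E) 𝓘(ℝ, ℝ) ∞ (fun x => μ x X)
  eq : ∀ (X : GroupLieAlgebra 𝓘(ℝ, F) G) (x : M) (v : TangentSpace 𝓘(ℝ, E) x),
    mvfderiv 𝓘(ℝ, E) (fun y => μ y X) x v - μ x X * θ x v
      = fundamentalForm J x (A.fundamental x X) v

end Actions

section Covering

variable {E : Type*} [NormedAddCommGroup E] [NormedSpace ℝ E]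
  {M : Type*} [TopologicalSpace M] [ChartedSpace E M]
  {N : Type*} [TopologicalSpace N] [ChartedSpace E N]

/-- `φ` is a deck transformation of `p : N → M`. -/
def IsDeckTransformation (p : N → M) (φ : N ≃ₜ N) : Prop := ∀ x, p (φ x) = p x

/-- `p : N → M`, together with the primitive `h` of `p^*θ`, is the minimal covering of `M`:
a connected smooth Galois covering on which `θ` becomes the differential of `h`, such that the
homomorphism `φ ↦ h ∘ φ - h ∈ ℝ` on the deck transformation group has trivial kernel. -/
structure IsMinimalCovering (θ : OneForm E M) (p : N → M) (h : N → ℝ) : Prop where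
  connected : ConnectedSpace N
  surjective : Function.Surjective p
  covering : IsCoveringMap p
  localDiffeo : IsLocalDiffeomorph 𝓘(ℝ, E) 𝓘(ℝ, E) ∞ p
  galois : ∀ x y, p x = p y → ∃ φ : N ≃ₜ N, IsDeckTransformation p φ ∧ φ x = y
  primitive_smooth : ContMDiff 𝓘(ℝ, E) 𝓘(ℝ, ℝ) ∞ h
  primitive : ∀ (x : N) (v : TangentSpace 𝓘(ℝ, E) x),
    mvfderiv 𝓘(ℝ, E) h x v = θ (p x) (mfderiv 𝓘(ℝ, E) 𝓘(ℝ, E) p x v)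
  minimal : ∀ φ : N ≃ₜ N, IsDeckTransformation p φ → (∀ x, h (φ x) = h x) → ∀ x, φ x = x

/-- The lift to `N` of a field of endomorphisms along a local diffeomorphism `p : N → M`. -/
def liftEndField (J : EndField E M) (p : N → M) : EndField E N := fun x =>
  (mfderiv 𝓘(ℝ, E) 𝓘(ℝ, E) p x).inverse ∘L (J (p x)) ∘L (mfderiv 𝓘(ℝ, E) 𝓘(ℝ, E) p x)

/-- The `1`-form `d^c h = dh ∘ J`. -/
def dc (J : EndField E N) (h : N → ℝ) : OneForm E N := fun x =>
  (mvfderiv 𝓘(ℝ, E) h x) ∘L (J x)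

variable {K : Type*} [NormedAddCommGroup K] [NormedSpace ℝ K]
  {S : Type*} [TopologicalSpace S] [ChartedSpace K S]

/-- `S`, with its embedding `ι` into the minimal covering, is the hypersurface `h = 0`, which is
the manifold underlying the associated Sasakian manifold. -/
structure IsAssociatedHypersurface (h : N → ℝ) (ι : S → N) : Prop where
  embedding : Manifold.IsSmoothEmbedding 𝓘(ℝ, K) 𝓘(ℝ, E) ∞ ι
  codim_one : Module.finrank ℝ K + 1 = Module.finrank ℝ E
  range_eq : Set.range ι = {x | h x = 0}

/-- The contact form `η = -d^c h` of the associated Sasakian manifold. As `dh` is the lift of `θ`,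
this is the form `g(R, ·)` dual to the Reeb field `R = J θ^♯` in the induced metric. -/
def contactForm (J : EndField E M) (p : N → M) (h : N → ℝ) (ι : S → N) : OneForm K S := fun s =>
  -((dc (liftEndField J p) h (ι s)) ∘L (mfderiv 𝓘(ℝ, K) 𝓘(ℝ, E) ι s))

variable {F : Type*} [NormedAddCommGroup F] [NormedSpace ℝ F]
  {G : Type*} [TopologicalSpace G] [ChartedSpace F G] [Group G]

/-- The action `B` on `S` is induced by the action `A` on `M`: there is a smooth action on the
minimal covering that lifts `A` and restricts to `B`. -/
def IsInducedAction (p : N → M) (ι : S → N) (A : SmoothAction F G E M)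
    (B : SmoothAction F G K S) : Prop :=
  ∃ A' : SmoothAction F G E N, (∀ a x, p (A'.act a x) = A.act a (p x)) ∧
    ∀ a s, ι (B.act a s) = A'.act a (ι s)

/-- The action `B` preserves the contact form `η`. -/
def SmoothAction.IsContact (B : SmoothAction F G K S) (η : OneForm K S) : Prop :=
  ∀ (a : G) (s : S) (v : TangentSpace 𝓘(ℝ, K) s),
    η (B.act a s) (mfderiv 𝓘(ℝ, K) 𝓘(ℝ, K) (B.act a) s v) = η s v

/-- The contact moment map `S → 𝔤*`, `s ↦ (X ↦ η(X̄)(s))`, with `X̄` the fundamental vector field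
on `S`. -/
def contactMomentMap (B : SmoothAction F G K S) (η : OneForm K S) (s : S) : LieDual F G :=
  (η s) ∘L (B.fundamental s)

end Covering

end

end VaismanMoment

/-! Pulling back `dω = θ ∧ ω` along a holomorphic isometry and using that `· ∧ ω` is injective on
covectors in real dimension greater than two, one sees that `G` preserves `θ`. Hence `θ(X̄)` is
constant, and since `dμ^X - μ^X θ = ω(X̄, ·)`, a maximum of `±μ^X` along an orbit of the compact
group `G` forces this constant to be zero. Paths in `G` therefore lift to the minimal covering
without changing `h`, which produces the action on `S = h⁻¹(0)`.

Let `B = θ^♯`. It is parallel, commutes with `X̄`, and satisfies `D_B J = 0`, so that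
`D_B (J X̄) = 0`. It follows that `k = dμ^X(B)` solves `dk = k θ`, and a nonzero solution would
make `θ = d log |k|` exact. So `k = 0`, which says on the one hand that
`μ^X = -θ(J X̄)`, i.e. that `Φ = μ ∘ p` on `S`, and on the other hand that `μ` is constant along
the flow of `B`. This flow is complete, and its lift to the minimal covering increases `h` at unit
speed, so each of its orbits meets `S`.
-/

namespace VaismanMoment

open scoped Topology

section Calculus

variable {E : Type*} [NormedAddCommGroup E] [NormedSpace ℝ E]
  {M : Type*} [TopologicalSpace M] [ChartedSpace E M]
  {F : Type*} [NormedAddCommGroup F] [NormedSpace ℝ F]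
  {P : Type*} [TopologicalSpace P] [ChartedSpace F P]
  {V : Type*} [NormedAddCommGroup V] [NormedSpace ℝ V]

lemma mvfderiv_congr {f g : M → V} {x : M} (hfg : f =ᶠ[𝓝 x] g) (v : TangentSpace 𝓘(ℝ, E) x) :
    mvfderiv 𝓘(ℝ, E) f x v = mvfderiv 𝓘(ℝ, E) g x v :=
  DFunLike.congr_fun (hfg.mfderiv_eq (I := 𝓘(ℝ, E)) (I' := 𝓘(ℝ, V))) v

lemma mvfderiv_comp_mfderiv {f : M → P} {g : P → V} {x : M}
    (hg : MDifferentiableAt 𝓘(ℝ, F) 𝓘(ℝ, V) g (f x))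
    (hf : MDifferentiableAt 𝓘(ℝ, E) 𝓘(ℝ, F) f x) :
    mvfderiv 𝓘(ℝ, E) (g ∘ f) x = mvfderiv 𝓘(ℝ, F) g (f x) ∘L mfderiv 𝓘(ℝ, E) 𝓘(ℝ, F) f x :=
  mfderiv_comp x hg hf

lemma mvfderiv_eq_fderiv_comp_extChartAt_symm {g : M → V} {x : M}
    (hg : MDifferentiableAt 𝓘(ℝ, E) 𝓘(ℝ, V) g x) (v : TangentSpace 𝓘(ℝ, E) x) :
    mvfderiv 𝓘(ℝ, E) g x v
      = fderiv ℝ (g ∘ (extChartAt 𝓘(ℝ, E) x).symm) (extChartAt 𝓘(ℝ, E) x x) v := by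
  rw [hg.mvfderiv]
  simp only [writtenInExtChartAt, extChartAt_model_space_eq_id, modelWithCornersSelf_coe,
    Set.range_id, fderivWithin_univ]
  rfl

lemma mvfderiv_comp_extChartAt [IsManifold 𝓘(ℝ, E) 1 M] {x : M} {g : E → V}
    (hg : DifferentiableAt ℝ g (extChartAt 𝓘(ℝ, E) x x)) :
    mvfderiv 𝓘(ℝ, E) (g ∘ extChartAt 𝓘(ℝ, E) x) x = fderiv ℝ g (extChartAt 𝓘(ℝ, E) x x) := by
  refine (mvfderiv_comp_mfderiv hg.mdifferentiableAt
    (mdifferentiableAt_extChartAt (mem_chart_source _ _))).trans ?_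
  rw [mfderiv_extChartAt_self]
  exact mfderiv_eq_fderiv

lemma mvfderiv_real_comp {f : M → ℝ} {x : M} {r : ℝ → ℝ} {c : ℝ} (hr : HasDerivAt r c (f x))
    (hf : MDifferentiableAt 𝓘(ℝ, E) 𝓘(ℝ, ℝ) f x) (v : TangentSpace 𝓘(ℝ, E) x) :
    mvfderiv 𝓘(ℝ, E) (fun y => r (f y)) x v = c * mvfderiv 𝓘(ℝ, E) f x v := by
  rw [← Function.comp_def,
    mvfderiv_comp_apply x hr.differentiableAt.mdifferentiableAt hf]
  change mfderiv 𝓘(ℝ, ℝ) 𝓘(ℝ, ℝ) r (f x) (mvfderiv 𝓘(ℝ, E) f x v) = _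
  rw [mfderiv_eq_fderiv, hr.hasFDerivAt.fderiv]
  exact mul_comm (mvfderiv 𝓘(ℝ, E) f x v) c

lemma mvfderiv_exp_neg_mul {f w : M → ℝ} {x : M} (hf : MDifferentiableAt 𝓘(ℝ, E) 𝓘(ℝ, ℝ) f x)
    (hw : MDifferentiableAt 𝓘(ℝ, E) 𝓘(ℝ, ℝ) w x) (v : TangentSpace 𝓘(ℝ, E) x) :
    mvfderiv 𝓘(ℝ, E) (fun y => Real.exp (-f y) * w y) x v
      = Real.exp (-f x) * (mvfderiv 𝓘(ℝ, E) w x v - mvfderiv 𝓘(ℝ, E) f x v * w x) := by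
  have hexp : HasDerivAt (fun t : ℝ => Real.exp (-t)) (-Real.exp (-f x)) (f x) := by
    simpa only [mul_neg, mul_one] using (hasDerivAt_neg (f x)).exp
  have hd : MDifferentiableAt 𝓘(ℝ, E) 𝓘(ℝ, ℝ) (fun y => Real.exp (-f y)) x :=
    hexp.differentiableAt.mdifferentiableAt.comp x hf
  rw [mvfderiv_fun_mul hd hw]
  simp only [add_apply, smul_apply, smul_eq_mul, mvfderiv_real_comp hexp hf]
  ring

lemma mvfderiv_eq_zero_of_isLocalMax {f : M → ℝ} {x : M} (hf : IsLocalMax f x) :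
    mvfderiv 𝓘(ℝ, E) f x = 0 := by
  by_cases hd : MDifferentiableAt 𝓘(ℝ, E) 𝓘(ℝ, ℝ) f x
  · ext v
    rw [mvfderiv_eq_fderiv_comp_extChartAt_symm hd, IsLocalMax.fderiv_eq_zero]
    · rfl
    · have hc : Filter.Tendsto (extChartAt 𝓘(ℝ, E) x).symm (𝓝 (extChartAt 𝓘(ℝ, E) x x)) (𝓝 x) := by
        simpa only [ContinuousAt, extChartAt_to_inv] using
          continuousAt_extChartAt_symm (I := 𝓘(ℝ, E)) x
      filter_upwards [hc.eventually hf] with z hz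
      simpa only [Function.comp_apply, extChartAt_to_inv] using hz
  · ext v
    change mfderiv 𝓘(ℝ, E) 𝓘(ℝ, ℝ) f x v = 0
    rw [mfderiv_zero_of_not_mdifferentiableAt hd]
    rfl

/-! ### Functions with vanishing derivative -/

section LocallyConstant

variable {H : Type*} [TopologicalSpace H] {I : ModelWithCorners ℝ E H} [I.Boundaryless]
  {T : Type*} [TopologicalSpace T] [ChartedSpace H T] [IsManifold I 1 T]

lemma eventually_eq_of_eventually_mvfderiv_eq_zero {u : T → V} {x : T}
    (hu : ∀ᶠ y in 𝓝 x, MDifferentiableAt I 𝓘(ℝ, V) u y ∧ mvfderiv I u y = 0) :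
    ∀ᶠ y in 𝓝 x, u y = u x := by
  set φ := extChartAt I x
  have hev : ∀ᶠ z in 𝓝 (φ x), z ∈ φ.target ∧
      MDifferentiableAt I 𝓘(ℝ, V) u (φ.symm z) ∧ mvfderiv I u (φ.symm z) = 0 :=
    Filter.Eventually.and (extChartAt_target_mem_nhds (I := I) x) <|
      (continuousAt_extChartAt_symm (I := I) x).eventually (by rwa [extChartAt_to_inv])
  obtain ⟨r, hr, hball⟩ := Metric.eventually_nhds_iff_ball.1 hev
  have hderiv : ∀ z ∈ Metric.ball (φ x) r, HasFDerivAt (u ∘ φ.symm) (0 : E →L[ℝ] V) z := by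
    intro z hz
    obtain ⟨hzt, hd, hzero⟩ := hball z hz
    have hsymm : MDifferentiableAt 𝓘(ℝ, E) I φ.symm z :=
      ((contMDiffOn_extChartAt_symm (n := 1) x).contMDiffAt
        ((isOpen_extChartAt_target x).mem_nhds hzt)).mdifferentiableAt one_ne_zero
    refine (hd.hasMFDerivAt.comp z hsymm.hasMFDerivAt).hasFDerivAt.congr_fderiv ?_
    ext v
    exact DFunLike.congr_fun hzero (mfderiv 𝓘(ℝ, E) I φ.symm z v)
  have hconst : ∀ z ∈ Metric.ball (φ x) r, u (φ.symm z) = u (φ.symm (φ x)) := fun z hz =>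
    (convex_ball (φ x) r).is_const_of_fderivWithin_eq_zero (𝕜 := ℝ)
      (fun w hw => (hderiv w hw).differentiableAt.differentiableWithinAt)
      (fun w hw => by rw [fderivWithin_of_isOpen Metric.isOpen_ball hw, (hderiv w hw).fderiv])
      hz (Metric.mem_ball_self hr)
  filter_upwards [extChartAt_source_mem_nhds (I := I) x,
    (continuousAt_extChartAt x).eventually (Metric.ball_mem_nhds (φ x) hr)] with y hy hyr
  simpa only [φ, φ.left_inv hy, extChartAt_to_inv] using hconst (φ y) hyr

lemma isLocallyConstant_of_mvfderiv_eq_zero {u : T → V} (hu : MDifferentiable I 𝓘(ℝ, V) u)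
    (hu0 : ∀ x, mvfderiv I u x = 0) : IsLocallyConstant u :=
  (IsLocallyConstant.iff_eventually_eq u).2 fun _ =>
    eventually_eq_of_eventually_mvfderiv_eq_zero (.of_forall fun y => ⟨hu y, hu0 y⟩)

end LocallyConstant

/-! ### Mixed partial derivatives -/

lemma hasFDerivAt_fderiv_partial_left {W : F × E → V} {z : F × E} (hW : ContDiffAt ℝ 2 W z)
    (v : E) :
    HasFDerivAt (fun s => fderiv ℝ (fun t => W (s, t)) z.2 v)
      (((fderiv ℝ (fderiv ℝ W) z).flip (0, v)) ∘L ContinuousLinearMap.inl ℝ F E) z.1 := by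
  have hd : DifferentiableAt ℝ (fderiv ℝ W) z :=
    (hW.fderiv_right (m := 1) (by norm_num)).differentiableAt one_ne_zero
  have hpartial : (fun s => fderiv ℝ (fun t => W (s, t)) z.2 v)
      =ᶠ[𝓝 z.1] fun s => fderiv ℝ W (s, z.2) (0, v) := by
    have hs : Filter.Tendsto (fun s => (s, z.2)) (𝓝 z.1) (𝓝 z) :=
      Continuous.tendsto (by fun_prop) z.1
    filter_upwards [hs.eventually (hW.eventually (by simp))] with s hWs
    have := (hWs.differentiableAt two_ne_zero).hasFDerivAt.comp z.2 (hasFDerivAt_prodMk_right s z.2)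
    exact DFunLike.congr_fun this.fderiv v
  refine HasFDerivAt.congr_of_eventuallyEq ?_ hpartial
  have hcomp := hd.hasFDerivAt.comp (f := fun s => (s, z.2)) z.1 (hasFDerivAt_prodMk_left z.1 z.2)
  exact (hcomp.clm_apply (hasFDerivAt_const ((0 : F), v) z.1)).congr_fderiv (by ext; simp)

lemma hasFDerivAt_fderiv_partial_right {W : F × E → V} {z : F × E} (hW : ContDiffAt ℝ 2 W z)
    (X : F) :
    HasFDerivAt (fun t => fderiv ℝ (fun s => W (s, t)) z.1 X)
      (((fderiv ℝ (fderiv ℝ W) z).flip (X, 0)) ∘L ContinuousLinearMap.inr ℝ F E) z.2 := by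
  have hd : DifferentiableAt ℝ (fderiv ℝ W) z :=
    (hW.fderiv_right (m := 1) (by norm_num)).differentiableAt one_ne_zero
  have hpartial : (fun t => fderiv ℝ (fun s => W (s, t)) z.1 X)
      =ᶠ[𝓝 z.2] fun t => fderiv ℝ W (z.1, t) (X, 0) := by
    have ht : Filter.Tendsto (fun t => (z.1, t)) (𝓝 z.2) (𝓝 z) :=
      Continuous.tendsto (by fun_prop) z.2
    filter_upwards [ht.eventually (hW.eventually (by simp))] with t hWt
    have := (hWt.differentiableAt two_ne_zero).hasFDerivAt.comp (f := fun s => (s, t)) z.1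
      (hasFDerivAt_prodMk_left z.1 t)
    exact DFunLike.congr_fun this.fderiv X
  refine HasFDerivAt.congr_of_eventuallyEq ?_ hpartial
  have hcomp := hd.hasFDerivAt.comp (f := fun t => (z.1, t)) z.2 (hasFDerivAt_prodMk_right z.1 z.2)
  exact (hcomp.clm_apply (hasFDerivAt_const (X, (0 : E)) z.2)).congr_fderiv (by ext; simp)

lemma fderiv_fderiv_partial_comm {W : F × E → V} {z : F × E} (hW : ContDiffAt ℝ 2 W z)
    (X : F) (v : E) :
    fderiv ℝ (fun s => fderiv ℝ (fun t => W (s, t)) z.2 v) z.1 X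
      = fderiv ℝ (fun t => fderiv ℝ (fun s => W (s, t)) z.1 X) z.2 v := by
  rw [(hasFDerivAt_fderiv_partial_left hW v).fderiv, (hasFDerivAt_fderiv_partial_right hW X).fderiv]
  exact hW.isSymmSndFDerivAt (by simp) _ _

lemma contDiffAt_comp_prodMap_extChartAt_symm {n : WithTop ℕ∞} [IsManifold 𝓘(ℝ, E) n M]
    [IsManifold 𝓘(ℝ, F) n P] {w : P × M → V} {q : P × M}
    (hw : ContMDiffAt (𝓘(ℝ, F).prod 𝓘(ℝ, E)) 𝓘(ℝ, V) n w q) :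
    ContDiffAt ℝ n (w ∘ Prod.map (extChartAt 𝓘(ℝ, F) q.1).symm (extChartAt 𝓘(ℝ, E) q.2).symm)
      (extChartAt 𝓘(ℝ, F) q.1 q.1, extChartAt 𝓘(ℝ, E) q.2 q.2) := by
  have hsymmP : ContMDiffAt 𝓘(ℝ, F) 𝓘(ℝ, F) n (extChartAt 𝓘(ℝ, F) q.1).symm _ :=
    (contMDiffOn_extChartAt_symm q.1).contMDiffAt (extChartAt_target_mem_nhds q.1)
  have hsymmM : ContMDiffAt 𝓘(ℝ, E) 𝓘(ℝ, E) n (extChartAt 𝓘(ℝ, E) q.2).symm _ :=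
    (contMDiffOn_extChartAt_symm q.2).contMDiffAt (extChartAt_target_mem_nhds q.2)
  have hcomp : ContMDiffAt (𝓘(ℝ, F).prod 𝓘(ℝ, E)) 𝓘(ℝ, V) n
      (w ∘ Prod.map (extChartAt 𝓘(ℝ, F) q.1).symm (extChartAt 𝓘(ℝ, E) q.2).symm)
      (extChartAt 𝓘(ℝ, F) q.1 q.1, extChartAt 𝓘(ℝ, E) q.2 q.2) := by
    refine ContMDiffAt.comp _ ?_ (hsymmP.prodMap hsymmM)
    simpa only [Prod.map_apply, extChartAt_to_inv] using hw
  rw [← modelWithCornersSelf_prod, chartedSpaceSelf_prod] at hcomp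
  exact hcomp.contDiffAt

lemma mvfderiv_mvfderiv_eq_fderiv_fderiv [IsManifold 𝓘(ℝ, E) 2 M] [IsManifold 𝓘(ℝ, F) 2 P]
    {w : P → M → V} {a : P} {x : M}
    (hw : ContMDiffAt (𝓘(ℝ, F).prod 𝓘(ℝ, E)) 𝓘(ℝ, V) 2 (Function.uncurry w) (a, x))
    (X : TangentSpace 𝓘(ℝ, F) a) (v : TangentSpace 𝓘(ℝ, E) x) :
    mvfderiv 𝓘(ℝ, F) (fun b => mvfderiv 𝓘(ℝ, E) (w b) x v) a X
      = fderiv ℝ (fun s => fderiv ℝ (fun t => w ((extChartAt 𝓘(ℝ, F) a).symm s)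
          ((extChartAt 𝓘(ℝ, E) x).symm t)) (extChartAt 𝓘(ℝ, E) x x) v)
          (extChartAt 𝓘(ℝ, F) a a) X := by
  set φ := extChartAt 𝓘(ℝ, F) a
  set ψ := extChartAt 𝓘(ℝ, E) x
  have hW : ContDiffAt ℝ 2 (fun z : F × E => w (φ.symm z.1) (ψ.symm z.2)) (φ a, ψ x) :=
    contDiffAt_comp_prodMap_extChartAt_symm hw
  have hchart : (fun b => mvfderiv 𝓘(ℝ, E) (w b) x v)
      =ᶠ[𝓝 a] (fun s => fderiv ℝ (fun t => w (φ.symm s) (ψ.symm t)) (ψ x) v) ∘ φ := by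
    have hb : Filter.Tendsto (fun b => (b, x)) (𝓝 a) (𝓝 (a, x)) :=
      Continuous.tendsto (by fun_prop) a
    filter_upwards [hb.eventually ((contMDiffAt_iff_contMDiffAt_nhds (by simp)).1 hw),
      extChartAt_source_mem_nhds (I := 𝓘(ℝ, F)) a] with b hwb hbs
    have hwbx : MDifferentiableAt 𝓘(ℝ, E) 𝓘(ℝ, V) (w b) x :=
      (ContMDiffAt.comp x hwb
        (contMDiffAt_const.prodMk contMDiffAt_id)).mdifferentiableAt two_ne_zero
    refine (mvfderiv_eq_fderiv_comp_extChartAt_symm hwbx v).trans ?_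
    rw [Function.comp_apply, φ.left_inv hbs]
    rfl
  exact (mvfderiv_congr hchart X).trans <| DFunLike.congr_fun
    (mvfderiv_comp_extChartAt (hasFDerivAt_fderiv_partial_left hW v).differentiableAt) X

lemma mvfderiv_mvfderiv_comm [IsManifold 𝓘(ℝ, E) 2 M] [IsManifold 𝓘(ℝ, F) 2 P]
    {w : P → M → V} {a : P} {x : M}
    (hw : ContMDiffAt (𝓘(ℝ, F).prod 𝓘(ℝ, E)) 𝓘(ℝ, V) 2 (Function.uncurry w) (a, x))
    (X : TangentSpace 𝓘(ℝ, F) a) (v : TangentSpace 𝓘(ℝ, E) x) :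
    mvfderiv 𝓘(ℝ, F) (fun b => mvfderiv 𝓘(ℝ, E) (fun y => w b y) x v) a X
      = mvfderiv 𝓘(ℝ, E) (fun y => mvfderiv 𝓘(ℝ, F) (fun b => w b y) a X) x v := by
  have hswap : ContMDiffAt (𝓘(ℝ, E).prod 𝓘(ℝ, F)) 𝓘(ℝ, V) 2
      (Function.uncurry fun y b => w b y) (x, a) :=
    ContMDiffAt.comp (g := Function.uncurry w) (x, a) hw (contMDiffAt_snd.prodMk contMDiffAt_fst)
  exact (mvfderiv_mvfderiv_eq_fderiv_fderiv hw X v).trans <|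
    (fderiv_fderiv_partial_comm (contDiffAt_comp_prodMap_extChartAt_symm hw) X v).trans
      (mvfderiv_mvfderiv_eq_fderiv_fderiv hswap v X).symm

/-! ### The Lie bracket as a commutator of derivations -/

lemma hasFDerivAt_fderiv_apply {g : E → V} {X : E → E} {x : E} (hg : ContDiffAt ℝ 2 g x)
    (hX : DifferentiableAt ℝ X x) :
    HasFDerivAt (fun y => fderiv ℝ g y (X y))
      (fderiv ℝ g x ∘L fderiv ℝ X x + (fderiv ℝ (fderiv ℝ g) x).flip (X x)) x :=
  ((hg.fderiv_right (m := 1) (by norm_num)).differentiableAt one_ne_zero).hasFDerivAt.clm_apply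
    hX.hasFDerivAt

lemma fderiv_lieBracket {g : E → V} {X Y : E → E} {x : E} (hg : ContDiffAt ℝ 2 g x)
    (hX : DifferentiableAt ℝ X x) (hY : DifferentiableAt ℝ Y x) :
    fderiv ℝ g x (VectorField.lieBracket ℝ X Y x)
      = fderiv ℝ (fun y => fderiv ℝ g y (Y y)) x (X x)
        - fderiv ℝ (fun y => fderiv ℝ g y (X y)) x (Y x) := by
  have hsymm : fderiv ℝ (fderiv ℝ g) x (X x) (Y x) = fderiv ℝ (fderiv ℝ g) x (Y x) (X x) :=
    hg.isSymmSndFDerivAt (by simp) (X x) (Y x)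
  rw [(hasFDerivAt_fderiv_apply hg hX).fderiv, (hasFDerivAt_fderiv_apply hg hY).fderiv]
  simp only [VectorField.lieBracket, map_sub, add_apply,
    ContinuousLinearMap.comp_apply, ContinuousLinearMap.flip_apply, hsymm]
  abel

lemma mvfderiv_comp_mpullback {f : M → P} {g : P → V} {x : M}
    (hg : MDifferentiableAt 𝓘(ℝ, F) 𝓘(ℝ, V) g (f x))
    (hf : MDifferentiableAt 𝓘(ℝ, E) 𝓘(ℝ, F) f x)
    (hinv : (mfderiv 𝓘(ℝ, E) 𝓘(ℝ, F) f x).IsInvertible) (X : VField F P) :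
    mvfderiv 𝓘(ℝ, E) (g ∘ f) x (VectorField.mpullback 𝓘(ℝ, E) 𝓘(ℝ, F) f X x)
      = mvfderiv 𝓘(ℝ, F) g (f x) (X (f x)) := by
  rw [mvfderiv_comp_mfderiv hg hf, ContinuousLinearMap.comp_apply, VectorField.mpullback_apply,
    hinv.self_apply_inverse]

lemma contDiffAt_comp_extChartAt_symm {n : WithTop ℕ∞} [IsManifold 𝓘(ℝ, E) n M] {g : M → V}
    {x : M} (hg : ContMDiffAt 𝓘(ℝ, E) 𝓘(ℝ, V) n g x) :
    ContDiffAt ℝ n (g ∘ (extChartAt 𝓘(ℝ, E) x).symm) (extChartAt 𝓘(ℝ, E) x x) := by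
  have hφ : ContMDiffAt 𝓘(ℝ, E) 𝓘(ℝ, E) n (extChartAt 𝓘(ℝ, E) x).symm _ :=
    (contMDiffOn_extChartAt_symm x).contMDiffAt (extChartAt_target_mem_nhds x)
  exact (ContMDiffAt.comp _ (by simpa only [extChartAt_to_inv] using hg) hφ).contDiffAt

lemma eventually_contMDiffAt_isInvertible_extChartAt_symm [IsManifold 𝓘(ℝ, E) ∞ M] (x : M) :
    ∀ᶠ z in 𝓝 (extChartAt 𝓘(ℝ, E) x x),
      ContMDiffAt 𝓘(ℝ, E) 𝓘(ℝ, E) ∞ (extChartAt 𝓘(ℝ, E) x).symm z ∧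
      (mfderiv 𝓘(ℝ, E) 𝓘(ℝ, E) (extChartAt 𝓘(ℝ, E) x).symm z).IsInvertible := by
  filter_upwards [extChartAt_target_mem_nhds (I := 𝓘(ℝ, E)) x] with z hz
  refine ⟨(contMDiffOn_extChartAt_symm x).contMDiffAt
    ((isOpen_extChartAt_target x).mem_nhds hz), ?_⟩
  have : IsManifold 𝓘(ℝ, E) 1 M := inferInstance
  simpa only [modelWithCornersSelf_coe, Set.range_id, mfderivWithin_univ] using
    isInvertible_mfderivWithin_extChartAt_symm hz

/-- The representative of a vector field in the chart centred at `x`, a vector field on the model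
space. -/
noncomputable def VField.inChart (X : VField E M) (x : M) : E → E :=
  VectorField.mpullback 𝓘(ℝ, E) 𝓘(ℝ, E) (extChartAt 𝓘(ℝ, E) x).symm X

lemma VField.DiffAt.differentiableAt_inChart [IsManifold 𝓘(ℝ, E) ∞ M] [CompleteSpace E]
    {X : VField E M} {x : M} (hX : X.DiffAt x) :
    DifferentiableAt ℝ (X.inChart x) (extChartAt 𝓘(ℝ, E) x x) := by
  have := (MDifferentiableAt.mdifferentiableWithinAt (s := Set.univ)
    hX).differentiableWithinAt_mpullbackWithin_vectorField
  rw [Set.preimage_univ, Set.univ_inter, modelWithCornersSelf_coe, Set.range_id,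
    VectorField.mpullbackWithin_univ] at this
  exact differentiableWithinAt_univ.1 this

lemma mvfderiv_apply_eventuallyEq_inChart [IsManifold 𝓘(ℝ, E) ∞ M] {g : M → V} {x : M}
    (hg : ContMDiffAt 𝓘(ℝ, E) 𝓘(ℝ, V) 1 g x) (X : VField E M) :
    (fun y => mvfderiv 𝓘(ℝ, E) g y (X y)) =ᶠ[𝓝 x]
      (fun z => fderiv ℝ (g ∘ (extChartAt 𝓘(ℝ, E) x).symm) z (X.inChart x z))
        ∘ extChartAt 𝓘(ℝ, E) x := by
  have : IsManifold 𝓘(ℝ, E) 1 M := inferInstance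
  filter_upwards [(contMDiffAt_iff_contMDiffAt_nhds (by simp)).1 hg,
    (continuousAt_extChartAt (I := 𝓘(ℝ, E)) x).eventually
      (eventually_contMDiffAt_isInvertible_extChartAt_symm x),
    extChartAt_source_mem_nhds (I := 𝓘(ℝ, E)) x] with y hgy ⟨hφ, hinv⟩ hy
  have hgy' : MDifferentiableAt 𝓘(ℝ, E) 𝓘(ℝ, V) g
      ((extChartAt 𝓘(ℝ, E) x).symm (extChartAt 𝓘(ℝ, E) x y)) := by
    simpa only [(extChartAt 𝓘(ℝ, E) x).left_inv hy] using hgy.mdifferentiableAt one_ne_zero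
  have hpull := mvfderiv_comp_mpullback hgy' (hφ.mdifferentiableAt (by simp)) hinv X
  rw [(extChartAt 𝓘(ℝ, E) x).left_inv hy] at hpull
  exact hpull.symm.trans (DFunLike.congr_fun (mfderiv_eq_fderiv (𝕜 := ℝ)) _)

lemma inChart_self [IsManifold 𝓘(ℝ, E) 1 M] (X : VField E M) (x : M) :
    X.inChart x (extChartAt 𝓘(ℝ, E) x x) = X x := by
  have h := mfderivWithin_range_extChartAt_symm (I := 𝓘(ℝ, E)) (x := x)
  rw [modelWithCornersSelf_coe, Set.range_id, mfderivWithin_univ] at h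
  rw [VField.inChart, VectorField.mpullback_apply, h]
  refine (DFunLike.congr_fun (ContinuousLinearMap.inverse_id (R := ℝ) (M := E)) _).trans ?_
  exact congrArg (fun y => (X y : E)) (extChartAt_to_inv x)

lemma mlieBracket_modelSpace (X Y : VField E E) :
    VectorField.mlieBracket 𝓘(ℝ, E) X Y = VectorField.lieBracket ℝ X Y := by
  rw [← VectorField.mlieBracketWithin_univ, VectorField.mlieBracketWithin_eq_lieBracketWithin]
  exact VectorField.lieBracketWithin_univ

lemma mlieBracket_eq_lieBracket_inChart [IsManifold 𝓘(ℝ, E) ∞ M] [CompleteSpace E] {x : M}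
    {X Y : VField E M} (hX : X.DiffAt x) (hY : Y.DiffAt x) :
    VectorField.mlieBracket 𝓘(ℝ, E) X Y x
      = VectorField.lieBracket ℝ (X.inChart x) (Y.inChart x) (extChartAt 𝓘(ℝ, E) x x) := by
  have : IsManifold 𝓘(ℝ, E) (minSmoothness ℝ 2) M := by
    rw [minSmoothness_of_isRCLikeNormedField]
    infer_instance
  have hpull := VectorField.mpullback_mlieBracket (I := 𝓘(ℝ, E)) (V := X) (W := Y) (n := ∞)
    (f := (extChartAt 𝓘(ℝ, E) x).symm) (x₀ := extChartAt 𝓘(ℝ, E) x x)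
    (by rw [extChartAt_to_inv]; exact hX) (by rw [extChartAt_to_inv]; exact hY)
    (eventually_contMDiffAt_isInvertible_extChartAt_symm x).self_of_nhds.1
    (minSmoothness_of_isRCLikeNormedField.trans_le (WithTop.coe_le_coe.2 le_top))
  exact (inChart_self (VectorField.mlieBracket 𝓘(ℝ, E) X Y) x).symm.trans
    (hpull.trans (congrFun (mlieBracket_modelSpace _ _) _))

lemma mvfderiv_mlieBracket [IsManifold 𝓘(ℝ, E) ∞ M] [CompleteSpace E]
    {g : M → V} {x : M} (hg : ContMDiffAt 𝓘(ℝ, E) 𝓘(ℝ, V) 2 g x)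
    {X Y : VField E M} (hX : X.DiffAt x) (hY : Y.DiffAt x) :
    mvfderiv 𝓘(ℝ, E) g x (VectorField.mlieBracket 𝓘(ℝ, E) X Y x)
      = mvfderiv 𝓘(ℝ, E) (fun y => mvfderiv 𝓘(ℝ, E) g y (Y y)) x (X x)
        - mvfderiv 𝓘(ℝ, E) (fun y => mvfderiv 𝓘(ℝ, E) g y (X y)) x (Y x) := by
  have : IsManifold 𝓘(ℝ, E) 1 M := inferInstance
  have : IsManifold 𝓘(ℝ, E) 2 M := inferInstance
  set ĝ := g ∘ (extChartAt 𝓘(ℝ, E) x).symm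
  have hĝ := contDiffAt_comp_extChartAt_symm hg
  have hinChart {Z : VField E M} (hZ : Z.DiffAt x) (v : TangentSpace 𝓘(ℝ, E) x) :
      mvfderiv 𝓘(ℝ, E) (fun y => mvfderiv 𝓘(ℝ, E) g y (Z y)) x v
        = fderiv ℝ (fun z => fderiv ℝ ĝ z (Z.inChart x z)) (extChartAt 𝓘(ℝ, E) x x) v :=
    (mvfderiv_congr (mvfderiv_apply_eventuallyEq_inChart (hg.of_le one_le_two) Z) v).trans <|
      DFunLike.congr_fun (mvfderiv_comp_extChartAt
        (hasFDerivAt_fderiv_apply hĝ hZ.differentiableAt_inChart).differentiableAt) v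
  rw [hinChart hX, hinChart hY, mvfderiv_eq_fderiv_comp_extChartAt_symm
    (hg.mdifferentiableAt two_ne_zero), mlieBracket_eq_lieBracket_inChart hX hY,
    ← inChart_self X, ← inChart_self Y]
  exact fderiv_lieBracket hĝ hX.differentiableAt_inChart hY.differentiableAt_inChart

end Calculus

/-! ### Smooth vector fields and one-forms -/

section Fields

variable {E : Type*} [NormedAddCommGroup E] [NormedSpace ℝ E]
  {M : Type*} [TopologicalSpace M] [ChartedSpace E M] [IsManifold 𝓘(ℝ, E) ∞ M]

lemma eq_zero_of_forall_mvfderiv_eq_zero {x : M} {v : TangentSpace 𝓘(ℝ, E) x}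
    (hv : ∀ u : M → ℝ, ContMDiffAt 𝓘(ℝ, E) 𝓘(ℝ, ℝ) ∞ u x → mvfderiv 𝓘(ℝ, E) u x v = 0) :
    v = 0 := by
  have : IsManifold 𝓘(ℝ, E) 1 M := inferInstance
  refine SeparatingDual.eq_zero_of_forall_dual_eq_zero (R := ℝ) (V := E) fun l => ?_
  have hl : mvfderiv 𝓘(ℝ, E) (l ∘ extChartAt 𝓘(ℝ, E) x) x = l :=
    (mvfderiv_comp_extChartAt l.differentiableAt).trans l.fderiv
  exact (DFunLike.congr_fun hl v).symm.trans
    (hv _ (l.contDiff.contMDiff.contMDiffAt.comp x contMDiffAt_extChartAt))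

/-- Smoothness at a point of a vector field, as a section of the tangent bundle. -/
def VField.SmoothAt (X : VField E M) (x : M) : Prop :=
  ContMDiffAt 𝓘(ℝ, E) (𝓘(ℝ, E).prod 𝓘(ℝ, E)) ∞
    (fun y => (⟨y, X y⟩ : TangentBundle 𝓘(ℝ, E) M)) x

/-- Smoothness at a point of a `1`-form, as a section of the cotangent bundle. -/
def OneForm.SmoothAt (θ : OneForm E M) (x : M) : Prop :=
  ContMDiffAt 𝓘(ℝ, E) (𝓘(ℝ, E).prod 𝓘(ℝ, E →L[ℝ] ℝ)) ∞
    (fun y => Bundle.TotalSpace.mk' (E →L[ℝ] ℝ)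
      (E := fun y : M => TangentSpace 𝓘(ℝ, E) y →L[ℝ] ℝ) y (θ y)) x

lemma VField.SmoothAt.diffAt {X : VField E M} {x : M} (hX : X.SmoothAt x) : X.DiffAt x :=
  ContMDiffAt.mdifferentiableAt hX (by simp)

lemma exists_smoothAt_eq (x : M) (v : TangentSpace 𝓘(ℝ, E) x) :
    ∃ X : VField E M, X.SmoothAt x ∧ X x = v :=
  ⟨FiberBundle.extend E v, FiberBundle.contMDiffAt_extend 𝓘(ℝ, E) E v,
    FiberBundle.extend_apply_self E v⟩

lemma EndField.IsSmooth.diffAt {J : EndField E M} (hJ : J.IsSmooth) {X : VField E M} {x : M}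
    (hX : X.DiffAt x) : VField.DiffAt (fun y => J y (X y)) x :=
  MDifferentiableAt.clm_bundle_apply ((hJ x).mdifferentiableAt (by simp)) hX

lemma OneForm.SmoothAt.mdifferentiableAt {θ : OneForm E M} {X : VField E M} {x : M}
    (hθ : θ.SmoothAt x) (hX : X.DiffAt x) :
    MDifferentiableAt 𝓘(ℝ, E) 𝓘(ℝ, ℝ) (fun y => θ y (X y)) x := by
  have h : MDifferentiableAt 𝓘(ℝ, E) (𝓘(ℝ, E).prod 𝓘(ℝ, ℝ))
      (fun y => Bundle.TotalSpace.mk' ℝ (E := Bundle.Trivial M ℝ) y (θ y (X y))) x :=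
    MDifferentiableAt.clm_bundle_apply (E₂ := Bundle.Trivial M ℝ)
      (ContMDiffAt.mdifferentiableAt hθ (by simp)) hX
  simp only [mdifferentiableAt_totalSpace] at h
  exact h.2

lemma OneForm.SmoothAt.contMDiffAt {θ : OneForm E M} {X : VField E M} {x : M}
    (hθ : θ.SmoothAt x) (hX : X.SmoothAt x) :
    ContMDiffAt 𝓘(ℝ, E) 𝓘(ℝ, ℝ) ∞ (fun y => θ y (X y)) x := by
  have h : ContMDiffAt 𝓘(ℝ, E) (𝓘(ℝ, E).prod 𝓘(ℝ, ℝ)) ∞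
      (fun y => Bundle.TotalSpace.mk' ℝ (E := Bundle.Trivial M ℝ) y (θ y (X y))) x :=
    ContMDiffAt.clm_bundle_apply (E₂ := Bundle.Trivial M ℝ) hθ hX
  simp only [Bundle.contMDiffAt_totalSpace] at h
  exact h.2

lemma OneForm.smoothAt_of_eventually_mvfderiv_eq {θ : OneForm E M} {f : M → ℝ} {x : M}
    (hf : ContMDiffAt 𝓘(ℝ, E) 𝓘(ℝ, ℝ) ∞ f x)
    (hfθ : ∀ᶠ y in 𝓝 x, mvfderiv 𝓘(ℝ, E) f y = θ y) : θ.SmoothAt x := by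
  unfold OneForm.SmoothAt
  rw [contMDiffAt_hom_bundle (E₂ := Bundle.Trivial M ℝ)]
  refine ⟨contMDiffAt_id,
    (hf.mfderiv_const (m := ∞) (by simp)).congr_of_eventuallyEq ?_⟩
  filter_upwards [hfθ, (trivializationAt E (TangentSpace 𝓘(ℝ, E)) x).open_baseSet.mem_nhds
    (FiberBundle.mem_baseSet_trivializationAt' x)] with y hy hyx
  unfold inTangentCoordinates
  rw [← hy, ContinuousLinearMap.inCoordinates_eq hyx (by simp),
    ContinuousLinearMap.inCoordinates_eq (by exact hyx)
      (by rw [TangentBundle.trivializationAt_baseSet]; exact Set.mem_univ _)]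
  ext v
  simp only [Bundle.Trivial.fiberBundle_trivializationAt',
    Bundle.Trivial.continuousLinearEquivAt_trivialization, ContinuousLinearEquiv.coe_refl, mvfderiv,
    ContinuousLinearMap.id_comp, ContinuousLinearMap.comp_apply, ContinuousLinearEquiv.coe_coe,
    Bundle.Trivialization.continuousLinearEquivAt_symm_apply, id_eq,
    Bundle.Trivialization.continuousLinearEquivAt_apply, trivializationAt_model_space_apply]
  rfl

end Fields

/-! ### The musical isomorphism -/

section BundleInverse

variable {n : WithTop ℕ∞}
  {EB : Type*} [NormedAddCommGroup EB] [NormedSpace ℝ EB]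
  {HB : Type*} [TopologicalSpace HB] {IB : ModelWithCorners ℝ EB HB}
  {B : Type*} [TopologicalSpace B] [ChartedSpace HB B]
  {F₁ : Type*} [NormedAddCommGroup F₁] [NormedSpace ℝ F₁] [CompleteSpace F₁]
  {E₁ : B → Type*} [∀ b, AddCommGroup (E₁ b)] [∀ b, Module ℝ (E₁ b)]
  [∀ b, TopologicalSpace (E₁ b)] [TopologicalSpace (Bundle.TotalSpace F₁ E₁)]
  [FiberBundle F₁ E₁] [VectorBundle ℝ F₁ E₁]
  {F₂ : Type*} [NormedAddCommGroup F₂] [NormedSpace ℝ F₂]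
  {E₂ : B → Type*} [∀ b, AddCommGroup (E₂ b)] [∀ b, Module ℝ (E₂ b)]
  [∀ b, TopologicalSpace (E₂ b)] [TopologicalSpace (Bundle.TotalSpace F₂ E₂)]
  [FiberBundle F₂ E₂] [VectorBundle ℝ F₂ E₂] [∀ b, IsTopologicalAddGroup (E₂ b)]
  [∀ b, ContinuousSMul ℝ (E₂ b)]

lemma contMDiffAt_inverse_bundle_apply {g : ∀ b, E₁ b →L[ℝ] E₂ b} {v : ∀ b, E₂ b} {b : B}
    (hg : ContMDiffAt IB (IB.prod 𝓘(ℝ, F₁ →L[ℝ] F₂)) n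
      (fun b => Bundle.TotalSpace.mk' (F₁ →L[ℝ] F₂) (E := fun b => E₁ b →L[ℝ] E₂ b) b (g b)) b)
    (hinv : ∀ b, (g b).IsInvertible)
    (hv : ContMDiffAt IB (IB.prod 𝓘(ℝ, F₂)) n (fun b => Bundle.TotalSpace.mk' F₂ b (v b)) b) :
    ContMDiffAt IB (IB.prod 𝓘(ℝ, F₁)) n
      (fun b => Bundle.TotalSpace.mk' F₁ b ((g b).inverse (v b))) b := by
  have hb₁ := FiberBundle.mem_baseSet_trivializationAt F₁ E₁ b
  have hb₂ := FiberBundle.mem_baseSet_trivializationAt F₂ E₂ b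
  refine ContMDiffAt.clm_apply_of_inCoordinates (b₁ := id) (b₂ := id)
    (ϕ := fun b => (g b).inverse) (v := v) ?_ hv contMDiffAt_id
  have hcoord : ContDiffAt ℝ n (ContinuousLinearMap.inverse : (F₁ →L[ℝ] F₂) → _)
      (ContinuousLinearMap.inCoordinates F₁ E₁ F₂ E₂ b b b b (g b)) := by
    apply ContinuousLinearMap.IsInvertible.contDiffAt_map_inverse
    rw [ContinuousLinearMap.inCoordinates_eq hb₁ hb₂]
    exact ContinuousLinearMap.isInvertible_equiv.comp
      ((hinv b).comp ContinuousLinearMap.isInvertible_equiv)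
  refine (hcoord.contMDiffAt.comp b ((contMDiffAt_hom_bundle _).1 hg).2).congr_of_eventuallyEq ?_
  filter_upwards [(trivializationAt F₁ E₁ b).open_baseSet.mem_nhds hb₁,
    (trivializationAt F₂ E₂ b).open_baseSet.mem_nhds hb₂] with y hy₁ hy₂
  rw [Function.comp_apply, ContinuousLinearMap.inCoordinates_eq (by exact hy₂) (by exact hy₁),
    ContinuousLinearMap.inCoordinates_eq hy₁ hy₂]
  simp only [ContinuousLinearMap.inverse_equiv_comp, ContinuousLinearMap.inverse_comp_equiv,
    ContinuousLinearEquiv.symm_symm]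
  rfl

end BundleInverse

section Sharp

variable {E : Type*} [NormedAddCommGroup E] [NormedSpace ℝ E] [FiniteDimensional ℝ E]
  {M : Type*} [TopologicalSpace M] [ChartedSpace E M]
  [Bundle.RiemannianBundle (fun x : M => TangentSpace 𝓘(ℝ, E) x)]

instance finiteDimensional_tangentSpace (x : M) : FiniteDimensional ℝ (TangentSpace 𝓘(ℝ, E) x) :=
  inferInstanceAs (FiniteDimensional ℝ E)

instance completeSpace_tangentSpace (x : M) : CompleteSpace (TangentSpace 𝓘(ℝ, E) x) :=
  FiniteDimensional.complete ℝ _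

/-- The vector field `θ^♯` dual to a `1`-form with respect to a Riemannian metric. -/
noncomputable def sharp (θ : OneForm E M) : VField E M := fun x =>
  (InnerProductSpace.toDual ℝ (TangentSpace 𝓘(ℝ, E) x)).symm (θ x)

lemma inner_sharp (θ : OneForm E M) (x : M) (v : TangentSpace 𝓘(ℝ, E) x) :
    inner ℝ (sharp θ x) v = θ x v :=
  InnerProductSpace.toDual_symm_apply

lemma norm_sharp (θ : OneForm E M) (x : M) : ‖sharp θ x‖ = ‖θ x‖ :=
  (InnerProductSpace.toDual ℝ (TangentSpace 𝓘(ℝ, E) x)).symm.norm_map (θ x)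

lemma sharp_smoothAt [IsManifold 𝓘(ℝ, E) ∞ M]
    [IsContMDiffRiemannianBundle 𝓘(ℝ, E) ∞ E (fun x : M => TangentSpace 𝓘(ℝ, E) x)]
    {θ : OneForm E M} {x : M} (hθ : θ.SmoothAt x) : (sharp θ).SmoothAt x := by
  obtain ⟨g, hg, hginner⟩ := IsContMDiffRiemannianBundle.exists_contMDiff
    (IB := 𝓘(ℝ, E)) (n := ∞) (F := E) (E := fun x : M => TangentSpace 𝓘(ℝ, E) x)
  have hinv (y : M) : (g y).IsInvertible := by
    refine ⟨(InnerProductSpace.toDual ℝ (TangentSpace 𝓘(ℝ, E) y)).toContinuousLinearEquiv, ?_⟩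
    ext v w
    exact hginner y v w
  have hsharp : sharp θ = fun y => (g y).inverse (θ y) := by
    funext y
    refine ((hinv y).inverse_apply_eq.2 ?_).symm
    ext v
    rw [← hginner, inner_sharp]
  rw [hsharp]
  exact contMDiffAt_inverse_bundle_apply (E₂ := fun y : M => TangentSpace 𝓘(ℝ, E) y →L[ℝ] ℝ)
    (hg x) hinv hθ

end Sharp

/-! ### Fundamental vector fields -/

section Actions

variable {F : Type*} [NormedAddCommGroup F] [NormedSpace ℝ F]
  {G : Type*} [TopologicalSpace G] [ChartedSpace F G] [Group G]
  {E : Type*} [NormedAddCommGroup E] [NormedSpace ℝ E]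
  {M : Type*} [TopologicalSpace M] [ChartedSpace E M]
  {V : Type*} [NormedAddCommGroup V] [NormedSpace ℝ V]

namespace SmoothAction

lemma contMDiff_act (A : SmoothAction F G E M) (a : G) : ContMDiff 𝓘(ℝ, E) 𝓘(ℝ, E) ∞ (A.act a) :=
  A.smooth.comp (contMDiff_const.prodMk contMDiff_id)

lemma mdifferentiable_act (A : SmoothAction F G E M) (a : G) :
    MDifferentiable 𝓘(ℝ, E) 𝓘(ℝ, E) (A.act a) :=
  (A.contMDiff_act a).mdifferentiable (by simp)

lemma contMDiff_orbit (A : SmoothAction F G E M) (x : M) :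
    ContMDiff 𝓘(ℝ, F) 𝓘(ℝ, E) ∞ (fun a => A.act a x) :=
  A.smooth.comp (contMDiff_id.prodMk contMDiff_const)

lemma tendsto_orbit (A : SmoothAction F G E M) (x : M) :
    Filter.Tendsto (fun a => A.act a x) (𝓝 1) (𝓝 x) := by
  simpa only [A.one_act] using (A.contMDiff_orbit x).continuous.tendsto 1

lemma inv_act_act (A : SmoothAction F G E M) (a : G) (x : M) : A.act a⁻¹ (A.act a x) = x := by
  rw [← A.mul_act, inv_mul_cancel, A.one_act]

lemma mfderiv_act_mfderiv_inv_act (A : SmoothAction F G E M) (a : G) (x : M) :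
    mfderiv 𝓘(ℝ, E) 𝓘(ℝ, E) (A.act a⁻¹) (A.act a x) ∘L mfderiv 𝓘(ℝ, E) 𝓘(ℝ, E) (A.act a) x
      = ContinuousLinearMap.id ℝ E := by
  rw [← mfderiv_comp x (A.mdifferentiable_act a⁻¹ _) (A.mdifferentiable_act a x),
    show A.act a⁻¹ ∘ A.act a = id from funext (A.inv_act_act a), mfderiv_id]
  rfl

lemma isInvertible_mfderiv (A : SmoothAction F G E M) (a : G) (x : M) :
    (mfderiv 𝓘(ℝ, E) 𝓘(ℝ, E) (A.act a) x).IsInvertible := by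
  have hright := A.mfderiv_act_mfderiv_inv_act a⁻¹ (A.act a x)
  rw [inv_inv, A.inv_act_act] at hright
  exact .of_inverse hright (A.mfderiv_act_mfderiv_inv_act a x)

lemma mvfderiv_fundamental (A : SmoothAction F G E M) {u : M → V} {x : M}
    (hu : MDifferentiableAt 𝓘(ℝ, E) 𝓘(ℝ, V) u x) (X : GroupLieAlgebra 𝓘(ℝ, F) G) :
    mvfderiv 𝓘(ℝ, F) (fun a => u (A.act a x)) 1 X
      = mvfderiv 𝓘(ℝ, E) u x (A.fundamental x X) := by
  have hu₁ : MDifferentiableAt 𝓘(ℝ, E) 𝓘(ℝ, V) u (A.act 1 x) := by rwa [A.one_act]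
  have hcomp := mvfderiv_comp_mfderiv (f := fun a => A.act a x) hu₁
    ((A.contMDiff_orbit x).mdifferentiableAt (by simp))
  refine (DFunLike.congr_fun hcomp X).trans ?_
  exact congrArg (fun y => (mvfderiv 𝓘(ℝ, E) u y : E →L[ℝ] V) (A.fundamental x X)) (A.one_act x)

lemma fundamental_smoothAt [IsManifold 𝓘(ℝ, F) ∞ G] [IsManifold 𝓘(ℝ, E) ∞ M]
    (A : SmoothAction F G E M) (X : GroupLieAlgebra 𝓘(ℝ, F) G) (x : M) :
    VField.SmoothAt (fun y => A.fundamental y X) x := by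
  have hfund := ContMDiffAt.mfderiv (I := 𝓘(ℝ, F)) (I' := 𝓘(ℝ, E)) (J := 𝓘(ℝ, E)) (n := ∞) (m := ∞)
    (x₀ := x) (fun (y : M) (a : G) => A.act a y) (fun _ => (1 : G))
    (ContMDiff.contMDiffAt (A.smooth.comp (contMDiff_snd.prodMk contMDiff_fst)))
    contMDiffAt_const (by simp)
  have hX : ContMDiffAt 𝓘(ℝ, E) (𝓘(ℝ, F).prod 𝓘(ℝ, F)) ∞
      (fun _ : M => (⟨1, X⟩ : TangentBundle 𝓘(ℝ, F) G)) x := contMDiffAt_const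
  refine (ContMDiffAt.clm_apply_of_inCoordinates (F₁ := F) (F₂ := E)
    (E₁ := TangentSpace 𝓘(ℝ, F) (M := G)) (E₂ := TangentSpace 𝓘(ℝ, E) (M := M))
    (b₁ := fun _ : M => (1 : G)) (b₂ := fun y => A.act 1 y) (v := fun _ => X) hfund hX
    (A.contMDiff_act 1 x)).congr_of_eventuallyEq (.of_forall fun y => ?_)
  exact Bundle.TotalSpace.ext (A.one_act y).symm HEq.rfl

variable [IsManifold 𝓘(ℝ, F) ∞ G] [IsManifold 𝓘(ℝ, E) ∞ M]

lemma mvfderiv_mvfderiv_act_comm (A : SmoothAction F G E M) {u : M → V} {x : M}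
    (hu : ContMDiffAt 𝓘(ℝ, E) 𝓘(ℝ, V) 2 u x) (X : GroupLieAlgebra 𝓘(ℝ, F) G)
    (v : TangentSpace 𝓘(ℝ, E) x) :
    mvfderiv 𝓘(ℝ, F) (fun a => mvfderiv 𝓘(ℝ, E) (fun y => u (A.act a y)) x v) 1 X
      = mvfderiv 𝓘(ℝ, E) (fun y => mvfderiv 𝓘(ℝ, E) u y (A.fundamental y X)) x v := by
  have : IsManifold 𝓘(ℝ, E) 2 M := inferInstance
  have : IsManifold 𝓘(ℝ, F) 2 G := inferInstance
  have hw : ContMDiffAt (𝓘(ℝ, F).prod 𝓘(ℝ, E)) 𝓘(ℝ, V) 2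
      (Function.uncurry fun a y => u (A.act a y)) (1, x) := by
    refine ContMDiffAt.comp (1, x) (g := u) ?_ (A.smooth.contMDiffAt.of_le ENat.LEInfty.out)
    simpa only [A.one_act] using hu
  rw [mvfderiv_mvfderiv_comm hw]
  refine mvfderiv_congr ?_ v
  filter_upwards [(contMDiffAt_iff_contMDiffAt_nhds (by simp)).1 hu] with y hy
  exact A.mvfderiv_fundamental (hy.mdifferentiableAt two_ne_zero) X

lemma mlieBracket_fundamental_eq_zero [CompleteSpace E] (A : SmoothAction F G E M)
    {Y : VField E M} {x : M} (hY : Y.DiffAt x)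
    (hinv : ∀ a, mfderiv 𝓘(ℝ, E) 𝓘(ℝ, E) (A.act a) x (Y x) = Y (A.act a x))
    (X : GroupLieAlgebra 𝓘(ℝ, F) G) :
    VectorField.mlieBracket 𝓘(ℝ, E) (fun y => A.fundamental y X) Y x = 0 := by
  have : IsManifold 𝓘(ℝ, E) 2 M := inferInstance
  refine eq_zero_of_forall_mvfderiv_eq_zero fun u hu => ?_
  have hu₂ : ContMDiffAt 𝓘(ℝ, E) 𝓘(ℝ, ℝ) 2 u x := hu.of_le ENat.LEInfty.out
  have huY : MDifferentiableAt 𝓘(ℝ, E) 𝓘(ℝ, ℝ) (fun y => mvfderiv 𝓘(ℝ, E) u y (Y y)) x :=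
    (OneForm.smoothAt_of_eventually_mvfderiv_eq (θ := fun y => mvfderiv 𝓘(ℝ, E) u y) hu
      (.of_forall fun _ => rfl)).mdifferentiableAt hY
  rw [mvfderiv_mlieBracket hu₂ (A.fundamental_smoothAt X x).diffAt hY, sub_eq_zero,
    ← A.mvfderiv_mvfderiv_act_comm hu₂, ← A.mvfderiv_fundamental huY X]
  refine mvfderiv_congr ?_ X
  filter_upwards [(A.tendsto_orbit x).eventually
    ((contMDiffAt_iff_contMDiffAt_nhds (by simp)).1 hu₂)] with a ha
  rw [← hinv a]
  exact (DFunLike.congr_fun (mvfderiv_comp_mfderiv (ha.mdifferentiableAt two_ne_zero)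
    (A.mdifferentiable_act a x)) (Y x)).symm

end SmoothAction

end Actions

/-! ### Locally conformally Kähler structures -/

section Lefschetz

variable {V : Type*} [NormedAddCommGroup V] [InnerProductSpace ℝ V]

lemma exists_ne_zero_inner_eq_zero (hdim : 2 < Module.finrank ℝ V) (v w : V) :
    ∃ u : V, u ≠ 0 ∧ inner ℝ v u = 0 ∧ inner ℝ w u = 0 := by
  have : FiniteDimensional ℝ V := Module.finite_of_finrank_pos (by omega)
  classical
  set W : Submodule ℝ V := Submodule.span ℝ ({v, w} : Finset V)
  have hW : Module.finrank ℝ W ≤ 2 := (finrank_span_finset_le_card _).trans Finset.card_le_two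
  have hpos : 0 < Module.finrank ℝ Wᗮ := by
    have := W.finrank_add_finrank_orthogonal
    omega
  obtain ⟨⟨u, hu⟩, hu0⟩ := Module.finrank_pos_iff_exists_ne_zero.1 hpos
  exact ⟨u, fun h => hu0 (Subtype.ext h), hu v (Submodule.subset_span (by simp)),
    hu w (Submodule.subset_span (by simp))⟩

/- The wedge `α ∧ ω` is evaluated on `v, u, j u` with `u` orthogonal to both `v` and `j v`. -/
lemma eq_zero_of_wedge_fundamentalForm_eq_zero (hdim : 2 < Module.finrank ℝ V) {j : V → V}
    (hherm : ∀ u v, inner ℝ (j u) (j v) = inner ℝ u v) {α : V → ℝ}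
    (hα : ∀ u v w, α u * inner ℝ (j v) w - α v * inner ℝ (j u) w + α w * inner ℝ (j u) v = 0) :
    α = 0 := by
  funext v
  obtain ⟨u, hu0, hvu, hjvu⟩ := exists_ne_zero_inner_eq_zero hdim v (j v)
  have hwedge := hα v u (j u)
  rw [hherm, hherm, hvu, hjvu, mul_zero, mul_zero, sub_zero, add_zero] at hwedge
  exact (mul_eq_zero.1 hwedge).resolve_right (inner_self_ne_zero.2 hu0)

end Lefschetz

section Pullback

variable {E : Type*} [NormedAddCommGroup E] [NormedSpace ℝ E] [CompleteSpace E]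
  {M : Type*} [TopologicalSpace M] [ChartedSpace E M] [IsManifold 𝓘(ℝ, E) ∞ M]
  {F : Type*} [NormedAddCommGroup F] [NormedSpace ℝ F]
  {P : Type*} [TopologicalSpace P] [ChartedSpace F P] [IsManifold 𝓘(ℝ, F) ∞ P]

lemma mfderiv_mlieBracket_mpullback {f : M → P} {x : M}
    (hf : ContMDiffAt 𝓘(ℝ, E) 𝓘(ℝ, F) ∞ f x)
    (hinv : (mfderiv 𝓘(ℝ, E) 𝓘(ℝ, F) f x).IsInvertible) {X Y : VField F P}
    (hX : X.DiffAt (f x)) (hY : Y.DiffAt (f x)) :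
    mfderiv 𝓘(ℝ, E) 𝓘(ℝ, F) f x (VectorField.mlieBracket 𝓘(ℝ, E)
        (VectorField.mpullback 𝓘(ℝ, E) 𝓘(ℝ, F) f X) (VectorField.mpullback 𝓘(ℝ, E) 𝓘(ℝ, F) f Y) x)
      = VectorField.mlieBracket 𝓘(ℝ, F) X Y (f x) := by
  have : IsManifold 𝓘(ℝ, E) (minSmoothness ℝ 2) M := by
    rw [minSmoothness_of_isRCLikeNormedField]; infer_instance
  have : IsManifold 𝓘(ℝ, F) (minSmoothness ℝ 2) P := by
    rw [minSmoothness_of_isRCLikeNormedField]; infer_instance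
  rw [← VectorField.mpullback_mlieBracket hX hY hf
    (minSmoothness_of_isRCLikeNormedField.trans_le (WithTop.coe_le_coe.2 le_top)),
    VectorField.mpullback_apply, hinv.self_apply_inverse]

lemma extDerivTwoForm_mpullback {f : M → P} {x : M} (hf : ContMDiffAt 𝓘(ℝ, E) 𝓘(ℝ, F) ∞ f x)
    (hinv : ∀ y, (mfderiv 𝓘(ℝ, E) 𝓘(ℝ, F) f y).IsInvertible)
    {β : (y : M) → TangentSpace 𝓘(ℝ, E) y → TangentSpace 𝓘(ℝ, E) y → ℝ}
    {γ : (z : P) → TangentSpace 𝓘(ℝ, F) z → TangentSpace 𝓘(ℝ, F) z → ℝ}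
    (hβγ : ∀ y u v, γ (f y) (mfderiv 𝓘(ℝ, E) 𝓘(ℝ, F) f y u) (mfderiv 𝓘(ℝ, E) 𝓘(ℝ, F) f y v)
      = β y u v)
    (hγ : ∀ X Y : VField F P, X.DiffAt (f x) → Y.DiffAt (f x) →
      MDifferentiableAt 𝓘(ℝ, F) 𝓘(ℝ, ℝ) (fun z => γ z (X z) (Y z)) (f x))
    {X Y Z : VField F P} (hX : X.DiffAt (f x)) (hY : Y.DiffAt (f x)) (hZ : Z.DiffAt (f x)) :
    extDerivTwoForm β (VectorField.mpullback 𝓘(ℝ, E) 𝓘(ℝ, F) f X)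
        (VectorField.mpullback 𝓘(ℝ, E) 𝓘(ℝ, F) f Y) (VectorField.mpullback 𝓘(ℝ, E) 𝓘(ℝ, F) f Z) x
      = extDerivTwoForm γ X Y Z (f x) := by
  have hpush (X : VField F P) (y : M) : mfderiv 𝓘(ℝ, E) 𝓘(ℝ, F) f y
      (VectorField.mpullback 𝓘(ℝ, E) 𝓘(ℝ, F) f X y) = X (f y) := by
    rw [VectorField.mpullback_apply, (hinv y).self_apply_inverse]
  have hderiv {X Y : VField F P} (hX : X.DiffAt (f x)) (hY : Y.DiffAt (f x)) (Z : VField F P) :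
      mvfderiv 𝓘(ℝ, E) (fun y => β y (VectorField.mpullback 𝓘(ℝ, E) 𝓘(ℝ, F) f X y)
        (VectorField.mpullback 𝓘(ℝ, E) 𝓘(ℝ, F) f Y y)) x
        (VectorField.mpullback 𝓘(ℝ, E) 𝓘(ℝ, F) f Z x)
      = mvfderiv 𝓘(ℝ, F) (fun z => γ z (X z) (Y z)) (f x) (Z (f x)) := by
    simp only [← hβγ, hpush]
    exact mvfderiv_comp_mpullback (hγ X Y hX hY) (hf.mdifferentiableAt (by simp)) (hinv x) Z
  unfold extDerivTwoForm
  rw [hderiv hY hZ, hderiv hX hZ, hderiv hX hY]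
  simp only [← hβγ x, hpush, mfderiv_mlieBracket_mpullback hf (hinv x) hX hY,
    mfderiv_mlieBracket_mpullback hf (hinv x) hX hZ,
    mfderiv_mlieBracket_mpullback hf (hinv x) hY hZ]

end Pullback

section LCK

variable {E : Type*} [NormedAddCommGroup E] [NormedSpace ℝ E]
  {M : Type*} [TopologicalSpace M] [ChartedSpace E M] [IsManifold 𝓘(ℝ, E) ∞ M]
  [Bundle.RiemannianBundle (fun x : M => TangentSpace 𝓘(ℝ, E) x)]
  {J : EndField E M} {θ : OneForm E M}

lemma IsLCK.exists_primitive (hM : IsLCK J θ) (x : M) :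
    ∃ f : M → ℝ, ContMDiffAt 𝓘(ℝ, E) 𝓘(ℝ, ℝ) ∞ f x ∧ ∀ᶠ y in 𝓝 x, mvfderiv 𝓘(ℝ, E) f y = θ y := by
  obtain ⟨U, hU, hx, f, hf, hfθ, -⟩ := hM.locallyConformal x
  exact ⟨f, hf.contMDiffAt (hU.mem_nhds hx), Filter.eventually_of_mem (hU.mem_nhds hx) hfθ⟩

lemma IsLCK.smoothAt (hM : IsLCK J θ) (x : M) : θ.SmoothAt x :=
  let ⟨_, hf, hfθ⟩ := hM.exists_primitive x
  OneForm.smoothAt_of_eventually_mvfderiv_eq hf hfθ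

lemma IsLCK.fundamentalForm_self (hM : IsLCK J θ) (x : M) (v : TangentSpace 𝓘(ℝ, E) x) :
    fundamentalForm J x v v = 0 := by
  have hskew := hM.hermitian x v (J x v)
  rw [hM.complex.sq_eq_neg, inner_neg_right, real_inner_comm] at hskew
  unfold fundamentalForm
  linarith [real_inner_comm v (J x v)]

variable [IsContMDiffRiemannianBundle 𝓘(ℝ, E) ∞ E (fun x : M => TangentSpace 𝓘(ℝ, E) x)]

lemma fundamentalForm_mdifferentiableAt (hJ : J.IsSmooth) {x : M} {Y Z : VField E M}
    (hY : Y.DiffAt x) (hZ : Z.DiffAt x) :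
    MDifferentiableAt 𝓘(ℝ, E) 𝓘(ℝ, ℝ) (fun y => fundamentalForm J y (Y y) (Z y)) x :=
  MDifferentiableAt.inner_bundle (E := fun y : M => TangentSpace 𝓘(ℝ, E) y) (hJ.diffAt hY) hZ

lemma IsLCK.extDerivTwoForm_fundamentalForm (hM : IsLCK J θ) {x : M} {X Y Z : VField E M}
    (hX : X.DiffAt x) (hY : Y.DiffAt x) (hZ : Z.DiffAt x) :
    extDerivTwoForm (fundamentalForm J) X Y Z x
      = θ x (X x) * fundamentalForm J x (Y x) (Z x) - θ x (Y x) * fundamentalForm J x (X x) (Z x)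
        + θ x (Z x) * fundamentalForm J x (X x) (Y x) := by
  obtain ⟨U, hU, hx, f, hf, hfθ, hclosed⟩ := hM.locallyConformal x
  have hconf := hclosed x hx X Y Z hX hY hZ
  have hJ := hM.complex.smooth
  have hfx : MDifferentiableAt 𝓘(ℝ, E) 𝓘(ℝ, ℝ) f x :=
    (hf.contMDiffAt (hU.mem_nhds hx)).mdifferentiableAt (by simp)
  unfold extDerivTwoForm at hconf ⊢
  rw [mvfderiv_exp_neg_mul hfx (fundamentalForm_mdifferentiableAt hJ hY hZ),
    mvfderiv_exp_neg_mul hfx (fundamentalForm_mdifferentiableAt hJ hX hZ),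
    mvfderiv_exp_neg_mul hfx (fundamentalForm_mdifferentiableAt hJ hX hY), hfθ x hx] at hconf
  refine mul_left_cancel₀ (Real.exp_pos (-f x)).ne' (sub_eq_zero.1 ?_)
  rw [← hconf]
  ring

end LCK

/-! ### The Lee form along a group action -/

section Invariance

variable {F : Type*} [NormedAddCommGroup F] [NormedSpace ℝ F]
  {G : Type*} [TopologicalSpace G] [ChartedSpace F G] [Group G]
  {E : Type*} [NormedAddCommGroup E] [NormedSpace ℝ E]
  {M : Type*} [TopologicalSpace M] [ChartedSpace E M] [IsManifold 𝓘(ℝ, E) ∞ M]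
  [Bundle.RiemannianBundle (fun x : M => TangentSpace 𝓘(ℝ, E) x)]
  {J : EndField E M} {θ : OneForm E M} {A : SmoothAction F G E M}

lemma SmoothAction.ByVaismanAutomorphisms.fundamentalForm_mfderiv
    (hA : A.ByVaismanAutomorphisms J) (a : G) (x : M) (u v : TangentSpace 𝓘(ℝ, E) x) :
    fundamentalForm J (A.act a x) (mfderiv 𝓘(ℝ, E) 𝓘(ℝ, E) (A.act a) x u)
      (mfderiv 𝓘(ℝ, E) 𝓘(ℝ, E) (A.act a) x v) = fundamentalForm J x u v := by
  unfold fundamentalForm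
  rw [← hA.holomorphic, hA.isometric]

variable [IsContMDiffRiemannianBundle 𝓘(ℝ, E) ∞ E (fun x : M => TangentSpace 𝓘(ℝ, E) x)]

/- Pulling back `dω = θ ∧ ω` gives `θ ∧ ω = a^*θ ∧ ω`, and `∧ ω` is injective on covectors. -/
lemma SmoothAction.ByVaismanAutomorphisms.lee_mfderiv
    (hA : A.ByVaismanAutomorphisms J) (hM : IsLCK J θ) (a : G) (x : M)
    (v : TangentSpace 𝓘(ℝ, E) x) :
    θ (A.act a x) (mfderiv 𝓘(ℝ, E) 𝓘(ℝ, E) (A.act a) x v) = θ x v := by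
  have : FiniteDimensional ℝ E := Module.finite_of_finrank_pos (pos_of_gt hM.two_lt_dim)
  have : CompleteSpace E := FiniteDimensional.complete ℝ E
  have : IsManifold 𝓘(ℝ, E) 2 M := inferInstance
  set L := mfderiv 𝓘(ℝ, E) 𝓘(ℝ, E) (A.act a) x
  have hL : L.IsInvertible := A.isInvertible_mfderiv a x
  have hact : ContMDiffAt 𝓘(ℝ, E) 𝓘(ℝ, E) ∞ (A.act a) x := A.contMDiff_act a x
  have hextend (w : TangentSpace 𝓘(ℝ, E) x) : ∃ X : VField E M, X.DiffAt (A.act a x) ∧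
      X (A.act a x) = L w ∧
      VField.DiffAt (VectorField.mpullback 𝓘(ℝ, E) 𝓘(ℝ, E) (A.act a) X) x ∧
      VectorField.mpullback 𝓘(ℝ, E) 𝓘(ℝ, E) (A.act a) X x = w := by
    obtain ⟨X, hX, hXw⟩ := exists_smoothAt_eq (A.act a x) (L w)
    refine ⟨X, hX.diffAt, hXw, MDifferentiableAt.mpullback_vectorField hX.diffAt hact hL
      ENat.LEInfty.out, ?_⟩
    rw [VectorField.mpullback_apply, hL.inverse_apply_eq, hXw]
  have hwedge (u v w : TangentSpace 𝓘(ℝ, E) x) :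
      (θ (A.act a x) (L u) - θ x u) * inner ℝ (J x v) w
        - (θ (A.act a x) (L v) - θ x v) * inner ℝ (J x u) w
        + (θ (A.act a x) (L w) - θ x w) * inner ℝ (J x u) v = 0 := by
    obtain ⟨X, hX, hXu, hX', hX'u⟩ := hextend u
    obtain ⟨Y, hY, hYv, hY', hY'v⟩ := hextend v
    obtain ⟨Z, hZ, hZw, hZ', hZ'w⟩ := hextend w
    have hpull := extDerivTwoForm_mpullback hact (A.isInvertible_mfderiv a)
      (hA.fundamentalForm_mfderiv a)
      (fun _ _ => fundamentalForm_mdifferentiableAt hM.complex.smooth) hX hY hZ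
    rw [hM.extDerivTwoForm_fundamentalForm hX hY hZ, hM.extDerivTwoForm_fundamentalForm hX' hY' hZ',
      hXu, hYv, hZw, hX'u, hY'v, hZ'w, hA.fundamentalForm_mfderiv, hA.fundamentalForm_mfderiv,
      hA.fundamentalForm_mfderiv] at hpull
    unfold fundamentalForm at hpull
    linarith
  exact sub_eq_zero.1 (congrFun (eq_zero_of_wedge_fundamentalForm_eq_zero
    (V := TangentSpace 𝓘(ℝ, E) x) hM.two_lt_dim (hM.hermitian x) hwedge) v)

/- With `f` a local primitive of `θ`, the mixed derivative of `f (a • y)` at `(1, x)` vanishes: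
differentiated first in `y`, it is the derivative in `a` of the constant `θ_x(v)`. -/
lemma SmoothAction.ByVaismanAutomorphisms.isLocallyConstant_lee_fundamental
    [IsManifold 𝓘(ℝ, F) ∞ G] (hA : A.ByVaismanAutomorphisms J) (hM : IsLCK J θ)
    (X : GroupLieAlgebra 𝓘(ℝ, F) G) : IsLocallyConstant (fun x => θ x (A.fundamental x X)) := by
  have : IsManifold 𝓘(ℝ, E) 1 M := inferInstance
  refine isLocallyConstant_of_mvfderiv_eq_zero (I := 𝓘(ℝ, E)) (fun x =>
    (hM.smoothAt x).mdifferentiableAt (A.fundamental_smoothAt X x).diffAt) fun x => ?_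
  ext v
  obtain ⟨f, hf, hfθ⟩ := hM.exists_primitive x
  have hf₂ : ContMDiffAt 𝓘(ℝ, E) 𝓘(ℝ, ℝ) 2 f x := hf.of_le ENat.LEInfty.out
  have hfund : (fun y => θ y (A.fundamental y X))
      =ᶠ[𝓝 x] fun y => mvfderiv 𝓘(ℝ, E) f y (A.fundamental y X) :=
    hfθ.mono fun y hy => congrArg (· (A.fundamental y X)) hy.symm
  have hconst : (fun a => mvfderiv 𝓘(ℝ, E) (fun y => f (A.act a y)) x v)
      =ᶠ[𝓝 (1 : G)] fun _ => θ x v := by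
    have : IsManifold 𝓘(ℝ, E) 2 M := inferInstance
    filter_upwards [(A.tendsto_orbit x).eventually
      (((contMDiffAt_iff_contMDiffAt_nhds (by simp)).1 hf₂).and hfθ)] with a ⟨hfa, hfθa⟩
    rw [← hA.lee_mfderiv hM a x, ← hfθa]
    exact DFunLike.congr_fun (mvfderiv_comp_mfderiv (hfa.mdifferentiableAt two_ne_zero)
      (A.mdifferentiable_act a x)) v
  rw [mvfderiv_congr hfund, ← A.mvfderiv_mvfderiv_act_comm hf₂, mvfderiv_congr hconst,
    mvfderiv_const]
  rfl

end Invariance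

section CompactGroup

variable {F : Type*} [NormedAddCommGroup F] [NormedSpace ℝ F]
  {G : Type*} [TopologicalSpace G] [ChartedSpace F G] [Group G] [CompactSpace G]
  {E : Type*} [NormedAddCommGroup E] [NormedSpace ℝ E]
  {M : Type*} [TopologicalSpace M] [ChartedSpace E M]

/- The maximum of `u` over a compact orbit is attained where `u` is critical along the orbit. -/
lemma SmoothAction.nonpos_of_eq_zero_of_mvfderiv_fundamental_eq_zero (A : SmoothAction F G E M)
    {u : M → ℝ} (hu : MDifferentiable 𝓘(ℝ, E) 𝓘(ℝ, ℝ) u) {X : GroupLieAlgebra 𝓘(ℝ, F) G}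
    (hcrit : ∀ y, mvfderiv 𝓘(ℝ, E) u y (A.fundamental y X) = 0 → u y = 0) (x : M) : u x ≤ 0 := by
  obtain ⟨a, -, ha⟩ := isCompact_univ.exists_isMaxOn ⟨(1 : G), Set.mem_univ _⟩
    (hu.continuous.comp (A.contMDiff_orbit x).continuous).continuousOn
  have hle (b : G) : u (A.act b x) ≤ u (A.act a x) := ha (Set.mem_univ b)
  have hmax : IsLocalMax (fun b => u (A.act b (A.act a x))) 1 := .of_forall fun b => by
    simpa only [← A.mul_act, one_mul] using hle (b * a)
  have hua : u (A.act a x) = 0 := hcrit _ <| by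
    rw [← A.mvfderiv_fundamental (hu _), mvfderiv_eq_zero_of_isLocalMax hmax]
    rfl
  simpa only [A.one_act, hua] using hle 1

variable [IsManifold 𝓘(ℝ, F) ∞ G] [IsManifold 𝓘(ℝ, E) ∞ M] [PreconnectedSpace M]
  [Bundle.RiemannianBundle (fun x : M => TangentSpace 𝓘(ℝ, E) x)]
  [IsContMDiffRiemannianBundle 𝓘(ℝ, E) ∞ E (fun x : M => TangentSpace 𝓘(ℝ, E) x)]
  {J : EndField E M} {θ : OneForm E M} {A : SmoothAction F G E M} {μ : M → LieDual F G}

/- If the constant `θ(X̄)` were nonzero, `μ^X` would vanish at its critical points along the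
orbits, hence identically, and then `ω(X̄, ·) = 0`. -/
lemma IsTwistedMomentMap.lee_fundamental_eq_zero (hμ : IsTwistedMomentMap J θ A μ)
    (hA : A.ByVaismanAutomorphisms J) (hM : IsLCK J θ) (X : GroupLieAlgebra 𝓘(ℝ, F) G) (x : M) :
    θ x (A.fundamental x X) = 0 := by
  by_contra hne
  have hconst (y : M) : θ y (A.fundamental y X) = θ x (A.fundamental x X) :=
    (hA.isLocallyConstant_lee_fundamental hM X).apply_eq_of_preconnectedSpace y x
  have hsmooth : MDifferentiable 𝓘(ℝ, E) 𝓘(ℝ, ℝ) (fun y => μ y X) :=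
    (hμ.smooth X).mdifferentiable (by simp)
  have hcrit (y : M) (hy : mvfderiv 𝓘(ℝ, E) (fun z => μ z X) y (A.fundamental y X) = 0) :
      μ y X = 0 := by
    have hμy := hμ.eq X y (A.fundamental y X)
    rw [hy, hM.fundamentalForm_self, hconst y, zero_sub, neg_eq_zero] at hμy
    exact (mul_eq_zero.1 hμy).resolve_right hne
  have hzero : (fun y => μ y X) = fun _ => 0 := funext fun y =>
    le_antisymm (A.nonpos_of_eq_zero_of_mvfderiv_fundamental_eq_zero hsmooth hcrit y) <|
      neg_nonpos.1 <| A.nonpos_of_eq_zero_of_mvfderiv_fundamental_eq_zero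
        (u := fun y => -μ y X) (X := X) (fun z => (hsmooth z).neg) (fun z hz => by
          rw [mvfderiv_fun_neg] at hz
          exact neg_eq_zero.2 (hcrit z (neg_eq_zero.1 hz))) y
  have hω := hμ.eq X x (J x (A.fundamental x X))
  rw [hzero, congrFun hzero x, mvfderiv_const, zero_mul, sub_zero, fundamentalForm,
    hM.hermitian] at hω
  exact hne (by rw [inner_self_eq_zero.1 hω.symm, map_zero])

end CompactGroup

/-! ### Lifting to the minimal covering -/

namespace IsMinimalCovering

section Lift

variable {E : Type*} [NormedAddCommGroup E] [NormedSpace ℝ E]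
  {M : Type*} [TopologicalSpace M] [ChartedSpace E M]
  {N : Type*} [TopologicalSpace N] [ChartedSpace E N]
  {θ : OneForm E M} {p : N → M} {h : N → ℝ}

lemma mdifferentiable (hp : IsMinimalCovering θ p h) : MDifferentiable 𝓘(ℝ, E) 𝓘(ℝ, E) p :=
  hp.localDiffeo.contMDiff.mdifferentiable (by simp)

lemma mdifferentiable_primitive (hp : IsMinimalCovering θ p h) :
    MDifferentiable 𝓘(ℝ, E) 𝓘(ℝ, ℝ) h :=
  hp.primitive_smooth.mdifferentiable (by simp)

lemma mvfderiv_primitive_comp_section (hp : IsMinimalCovering θ p h) {s : M → N} {y : M}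
    (hs : MDifferentiableAt 𝓘(ℝ, E) 𝓘(ℝ, E) s y) (hps : p ∘ s =ᶠ[𝓝 y] id) :
    mvfderiv 𝓘(ℝ, E) (h ∘ s) y = θ y := by
  ext v
  have hv : mfderiv 𝓘(ℝ, E) 𝓘(ℝ, E) p (s y) (mfderiv 𝓘(ℝ, E) 𝓘(ℝ, E) s y v) = v :=
    (mfderiv_comp_apply y (hp.mdifferentiable _) hs v).symm.trans
      (DFunLike.congr_fun (hps.mfderiv_eq.trans mfderiv_id) v)
  calc mvfderiv 𝓘(ℝ, E) (h ∘ s) y v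
      = mvfderiv 𝓘(ℝ, E) h (s y) (mfderiv 𝓘(ℝ, E) 𝓘(ℝ, E) s y v) :=
        DFunLike.congr_fun (mvfderiv_comp_mfderiv (hp.mdifferentiable_primitive _) hs) v
    _ = θ (p (s y)) (mfderiv 𝓘(ℝ, E) 𝓘(ℝ, E) p (s y) (mfderiv 𝓘(ℝ, E) 𝓘(ℝ, E) s y v)) :=
        hp.primitive _ _
    _ = θ (p (s y)) v := congrArg (θ (p (s y))) hv
    _ = θ y v := congrArg (fun z => (θ z : E →L[ℝ] ℝ) v) hps.self_of_nhds

variable {H' : Type*} [TopologicalSpace H'] {E' : Type*} [NormedAddCommGroup E'] [NormedSpace ℝ E']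
  {I : ModelWithCorners ℝ E' H'} [I.Boundaryless]
  {T : Type*} [TopologicalSpace T] [ChartedSpace H' T] [IsManifold I 1 T]
  {c : T → M} {w : T → ℝ}

/- Both sides have differential `c^*θ = dw`, because `h` composed with the section is a primitive
of `θ`. -/
lemma eventually_primitive_section (hp : IsMinimalCovering θ p h)
    (hc : MDifferentiable I 𝓘(ℝ, E) c) (hw : MDifferentiable I 𝓘(ℝ, ℝ) w)
    (hcw : ∀ t v, θ (c t) (mfderiv I 𝓘(ℝ, E) c t v) = mvfderiv I w t v)
    {t₀ : T} {n₀ : N} (hn₀ : p n₀ = c t₀) :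
    ∀ᶠ t in 𝓝 t₀, p ((hp.localDiffeo n₀).localInverse (c t)) = c t ∧
      h ((hp.localDiffeo n₀).localInverse (c t)) - h n₀ = w t - w t₀ := by
  set s := (hp.localDiffeo n₀).localInverse
  have hsource : ∀ᶠ t in 𝓝 t₀, c t ∈ s.source :=
    (hc t₀).continuousAt.eventually (s.open_source.mem_nhds
      (hn₀ ▸ (hp.localDiffeo n₀).localInverse_mem_source))
  have hderiv : ∀ᶠ t in 𝓝 t₀, MDifferentiableAt I 𝓘(ℝ, ℝ) (h ∘ s ∘ c - w) t ∧
      mvfderiv I (h ∘ s ∘ c - w) t = 0 := by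
    filter_upwards [hsource] with t ht
    have hmem := s.open_source.mem_nhds ht
    have hs : MDifferentiableAt 𝓘(ℝ, E) 𝓘(ℝ, E) s (c t) :=
      (s.contMDiffOn_toFun.contMDiffAt hmem).mdifferentiableAt (by simp)
    have hhs : MDifferentiableAt 𝓘(ℝ, E) 𝓘(ℝ, ℝ) (h ∘ s) (c t) :=
      (hp.mdifferentiable_primitive _).comp _ hs
    have hhsc : MDifferentiableAt I 𝓘(ℝ, ℝ) (h ∘ s ∘ c) t := hhs.comp t (hc t)
    refine ⟨hhsc.sub (hw t), ?_⟩
    ext v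
    rw [mvfderiv_sub hhsc (hw t)]
    refine sub_eq_zero.2 (((mfderiv_comp_apply t hhs (hc t) v).trans ?_).trans (hcw t v))
    exact DFunLike.congr_fun (hp.mvfderiv_primitive_comp_section hs
      (Filter.eventually_of_mem hmem fun y hy =>
        (hp.localDiffeo n₀).localInverse_right_inv hy)) (mfderiv I 𝓘(ℝ, E) c t v)
  have hs₀ : s (c t₀) = n₀ :=
    hn₀ ▸ (hp.localDiffeo n₀).localInverse_left_inv (hp.localDiffeo n₀).localInverse_mem_target
  filter_upwards [hsource, eventually_eq_of_eventually_mvfderiv_eq_zero hderiv] with t ht heq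
  refine ⟨(hp.localDiffeo n₀).localInverse_right_inv ht, ?_⟩
  simp only [Pi.sub_apply, Function.comp_apply, hs₀] at heq
  linarith

lemma primitive_deck_sub_eq [IsManifold 𝓘(ℝ, E) 1 N] (hp : IsMinimalCovering θ p h) {φ : N ≃ₜ N}
    (hφ : IsDeckTransformation p φ) (x y : N) : h (φ x) - h x = h (φ y) - h y := by
  have := hp.connected
  refine IsLocallyConstant.apply_eq_of_preconnectedSpace (f := fun z => h (φ z) - h z)
    ((IsLocallyConstant.iff_eventually_eq _).2 fun z => ?_) x y
  filter_upwards [hp.eventually_primitive_section hp.mdifferentiable hp.mdifferentiable_primitive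
      (fun t v => (hp.primitive t v).symm) (hφ z),
    φ.continuous.continuousAt.eventually
      (hp.localDiffeo (φ z)).localInverse_eventuallyEq_left] with t ht hst
  have hst' : (hp.localDiffeo (φ z)).localInverse (p t) = φ t := by rw [← hφ t]; exact hst
  linarith [hst' ▸ ht.2]

lemma eq_of_primitive_eq [IsManifold 𝓘(ℝ, E) 1 N] (hp : IsMinimalCovering θ p h) {x y : N}
    (hpxy : p x = p y) (hxy : h x = h y) : x = y := by
  obtain ⟨φ, hφ, rfl⟩ := hp.galois x y hpxy
  exact (hp.minimal φ hφ (fun z => by linarith [hp.primitive_deck_sub_eq hφ z x]) x).symm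

/- The points of `T` at which the required lift exists form an open set; it is closed because deck
transformations change `h` by constants. -/
lemma exists_lift_point [IsManifold 𝓘(ℝ, E) 1 N] [PreconnectedSpace T]
    (hp : IsMinimalCovering θ p h)
    (hc : MDifferentiable I 𝓘(ℝ, E) c) (hw : MDifferentiable I 𝓘(ℝ, ℝ) w)
    (hcw : ∀ t v, θ (c t) (mfderiv I 𝓘(ℝ, E) c t v) = mvfderiv I w t v)
    {t₁ : T} {n₁ : N} (hn₁ : p n₁ = c t₁) (t : T) :
    ∃ n, p n = c t ∧ h n - h n₁ = w t - w t₁ := by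
  set good : Set T := {t | ∃ n, p n = c t ∧ h n - h n₁ = w t - w t₁}
  have hopen : IsOpen good := by
    refine isOpen_iff_mem_nhds.2 fun t₀ ⟨n₀, hn₀, hh₀⟩ => ?_
    filter_upwards [hp.eventually_primitive_section hc hw hcw hn₀] with t ⟨hpt, hht⟩
    exact ⟨_, hpt, by linarith⟩
  have hclosed : IsClosed good := by
    refine isOpen_compl_iff.1 (isOpen_iff_mem_nhds.2 fun t₀ ht₀ => ?_)
    obtain ⟨n₀, hn₀⟩ := hp.surjective (c t₀)
    filter_upwards [hp.eventually_primitive_section hc hw hcw hn₀]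
    rintro t ⟨hpt, hht⟩ ⟨n, hn, hh⟩
    obtain ⟨φ, hφ, hφn⟩ := hp.galois _ n (hpt.trans hn.symm)
    refine ht₀ ⟨φ n₀, (hφ n₀).trans hn₀, ?_⟩
    linarith [hφn ▸ hp.primitive_deck_sub_eq hφ n₀ ((hp.localDiffeo n₀).localInverse (c t))]
  exact (IsClopen.eq_univ ⟨hclosed, hopen⟩ ⟨t₁, n₁, hn₁, by ring⟩).ge (Set.mem_univ t)

lemma contMDiff_of_lift [IsManifold 𝓘(ℝ, E) 1 N] (hp : IsMinimalCovering θ p h) {c' : T → N}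
    (hc : ContMDiff I 𝓘(ℝ, E) ∞ c) (hw : MDifferentiable I 𝓘(ℝ, ℝ) w)
    (hcw : ∀ t v, θ (c t) (mfderiv I 𝓘(ℝ, E) c t v) = mvfderiv I w t v)
    (hpc' : ∀ t, p (c' t) = c t) (hhc' : ∀ t, h (c' t) = w t) : ContMDiff I 𝓘(ℝ, E) ∞ c' := by
  intro t₀
  have hs := (hp.localDiffeo (c' t₀)).localInverse_contMDiffAt
  rw [hpc'] at hs
  refine (hs.comp t₀ hc.contMDiffAt).congr_of_eventuallyEq ?_
  filter_upwards [hp.eventually_primitive_section (hc.mdifferentiable (by simp)) hw hcw (hpc' t₀)]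
    with t ⟨hpt, hht⟩
  refine hp.eq_of_primitive_eq ((hpc' t).trans hpt.symm) ?_
  rw [hhc', Function.comp_apply]
  linarith [hhc' t₀]

end Lift

end IsMinimalCovering

section LiftAction

variable {F : Type*} [NormedAddCommGroup F] [NormedSpace ℝ F]
  {G : Type*} [TopologicalSpace G] [ChartedSpace F G] [Group G] [LieGroup 𝓘(ℝ, F) ∞ G]
  {E : Type*} [NormedAddCommGroup E] [NormedSpace ℝ E]
  {M : Type*} [TopologicalSpace M] [ChartedSpace E M]
  {N : Type*} [TopologicalSpace N] [ChartedSpace E N]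
  {θ : OneForm E M} {A : SmoothAction F G E M} {p : N → M} {h : N → ℝ}

lemma SmoothAction.exists_mfderiv_orbit_eq_fundamental (A : SmoothAction F G E M) (b : G) (x : M)
    (Y : TangentSpace 𝓘(ℝ, F) b) :
    ∃ X, mfderiv 𝓘(ℝ, F) 𝓘(ℝ, E) (fun a => A.act a x) b Y = A.fundamental (A.act b x) X := by
  have hmul : MDifferentiableAt 𝓘(ℝ, F) 𝓘(ℝ, F) (fun a : G => a * b⁻¹) b :=
    (contMDiff_mul_right (I := 𝓘(ℝ, F)) (n := ∞) (a := b⁻¹)).mdifferentiableAt (by simp)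
  have horbit : (fun a => A.act a x) = (fun a => A.act a (A.act b x)) ∘ (· * b⁻¹) := by
    ext a
    simp [← A.mul_act]
  refine ⟨mfderiv 𝓘(ℝ, F) 𝓘(ℝ, F) (· * b⁻¹) b Y, ?_⟩
  rw [horbit]
  exact mfderiv_comp_apply_of_eq (x := b)
    ((A.contMDiff_orbit _).mdifferentiableAt (by simp)) hmul (mul_inv_cancel b) Y

lemma IsMinimalCovering.lee_mfderiv_act_comp (hp : IsMinimalCovering θ p h)
    (hinv : ∀ a x v, θ (A.act a x) (mfderiv 𝓘(ℝ, E) 𝓘(ℝ, E) (A.act a) x v) = θ x v)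
    (hfund : ∀ X x, θ x (A.fundamental x X) = 0) (q : G × N)
    (v : TangentSpace (𝓘(ℝ, F).prod 𝓘(ℝ, E)) q) :
    θ (A.act q.1 (p q.2))
        (mfderiv (𝓘(ℝ, F).prod 𝓘(ℝ, E)) 𝓘(ℝ, E) (fun q : G × N => A.act q.1 (p q.2)) q v)
      = mvfderiv (𝓘(ℝ, F).prod 𝓘(ℝ, E)) (fun q : G × N => h q.2) q v := by
  have hact : MDifferentiable (𝓘(ℝ, F).prod 𝓘(ℝ, E)) 𝓘(ℝ, E)
      (fun q : G × N => A.act q.1 (p q.2)) :=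
    (A.smooth.comp (contMDiff_fst.prodMk (hp.localDiffeo.contMDiff.comp contMDiff_snd))
      ).mdifferentiable (by simp)
  obtain ⟨a, n⟩ := q
  obtain ⟨Y, u⟩ : TangentSpace 𝓘(ℝ, F) a × TangentSpace 𝓘(ℝ, E) n := v
  obtain ⟨X, hX⟩ := A.exists_mfderiv_orbit_eq_fundamental a (p n) Y
  have hu : mfderiv 𝓘(ℝ, E) 𝓘(ℝ, E) (fun n => A.act a (p n)) n u
      = mfderiv 𝓘(ℝ, E) 𝓘(ℝ, E) (A.act a) (p n) (mfderiv 𝓘(ℝ, E) 𝓘(ℝ, E) p n u) :=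
    mfderiv_comp_apply n (A.mdifferentiable_act a _) (hp.mdifferentiable n) u
  have hsnd : mvfderiv (𝓘(ℝ, F).prod 𝓘(ℝ, E)) (fun q : G × N => h q.2) (a, n) (Y, u)
      = mvfderiv 𝓘(ℝ, E) h n u :=
    (mfderiv_comp_apply (I := 𝓘(ℝ, F).prod 𝓘(ℝ, E)) (a, n) (g := h) (f := Prod.snd)
      (hp.mdifferentiable_primitive n) mdifferentiableAt_snd _).trans (by rw [mfderiv_snd]; rfl)
  calc _ = θ (A.act a (p n)) (mfderiv 𝓘(ℝ, F) 𝓘(ℝ, E) (fun b => A.act b (p n)) a Y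
          + mfderiv 𝓘(ℝ, E) 𝓘(ℝ, E) (fun n => A.act a (p n)) n u) :=
        congrArg (θ _) (mfderiv_prod_eq_add_apply (hact (a, n)))
    _ = mvfderiv 𝓘(ℝ, E) h n u := by rw [hX, hu, map_add, hfund, zero_add, hinv, hp.primitive]
    _ = _ := hsnd.symm

lemma IsMinimalCovering.exists_lift_action [PreconnectedSpace G] [IsManifold 𝓘(ℝ, E) ∞ N]
    (hp : IsMinimalCovering θ p h)
    (hinv : ∀ a x v, θ (A.act a x) (mfderiv 𝓘(ℝ, E) 𝓘(ℝ, E) (A.act a) x v) = θ x v)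
    (hfund : ∀ X x, θ x (A.fundamental x X) = 0) :
    ∃ A' : SmoothAction F G E N, (∀ a x, p (A'.act a x) = A.act a (p x)) ∧
      ∀ a x, h (A'.act a x) = h x := by
  have := hp.connected
  have : IsManifold 𝓘(ℝ, E) 1 N := inferInstance
  have : IsManifold 𝓘(ℝ, F) 1 G := IsManifold.of_le (n := ∞) (by simp)
  have hact : ContMDiff (𝓘(ℝ, F).prod 𝓘(ℝ, E)) 𝓘(ℝ, E) ∞
      (fun q : G × N => A.act q.1 (p q.2)) :=
    A.smooth.comp (contMDiff_fst.prodMk (hp.localDiffeo.contMDiff.comp contMDiff_snd))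
  have hh : MDifferentiable (𝓘(ℝ, F).prod 𝓘(ℝ, E)) 𝓘(ℝ, ℝ) (fun q : G × N => h q.2) :=
    (hp.primitive_smooth.comp contMDiff_snd).mdifferentiable (by simp)
  have hlift (a : G) (x : N) : ∃ y, p y = A.act a (p x) ∧ h y = h x := by
    obtain ⟨y, hpy, hhy⟩ := hp.exists_lift_point (hact.mdifferentiable (by simp)) hh
      (hp.lee_mfderiv_act_comp hinv hfund) (t₁ := (1, x)) (A.one_act (p x)).symm (a, x)
    exact ⟨y, hpy, by linarith⟩
  choose f hpf hhf using hlift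
  refine ⟨⟨f, fun x => ?_, fun a b x => ?_, ?_⟩, hpf, hhf⟩
  · exact hp.eq_of_primitive_eq (by rw [hpf, A.one_act]) (hhf _ _)
  · exact hp.eq_of_primitive_eq (by rw [hpf, hpf, hpf, A.mul_act]) (by rw [hhf, hhf, hhf])
  · exact hp.contMDiff_of_lift hact hh (hp.lee_mfderiv_act_comp hinv hfund)
      (fun q => hpf q.1 q.2) (fun q => hhf q.1 q.2)

end LiftAction

section Restrict

variable {F : Type*} [NormedAddCommGroup F] [NormedSpace ℝ F]
  {G : Type*} [TopologicalSpace G] [ChartedSpace F G] [Group G]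
  {E : Type*} [NormedAddCommGroup E] [NormedSpace ℝ E]
  {N : Type*} [TopologicalSpace N] [ChartedSpace E N]
  {K : Type*} [NormedAddCommGroup K] [NormedSpace ℝ K]
  {S : Type*} [TopologicalSpace S] [ChartedSpace K S]
  {h : N → ℝ} {ι : S → N}

lemma IsAssociatedHypersurface.primitive_eq_zero
    (hι : IsAssociatedHypersurface (E := E) (K := K) h ι) (s : S) : h (ι s) = 0 :=
  hι.range_eq.le ⟨s, rfl⟩

lemma IsAssociatedHypersurface.exists_restrict
    (hι : IsAssociatedHypersurface (E := E) (K := K) h ι) (A' : SmoothAction F G E N)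
    (hA' : ∀ a x, h (A'.act a x) = h x) :
    ∃ B : SmoothAction F G K S, ∀ a s, ι (B.act a s) = A'.act a (ι s) := by
  have hinj : Function.Injective ι := hι.embedding.isEmbedding.injective
  have hrestrict (a : G) (s : S) : ∃ t, ι t = A'.act a (ι s) :=
    hι.range_eq.ge (show h (A'.act a (ι s)) = 0 by rw [hA', hι.primitive_eq_zero])
  choose f hf using hrestrict
  have hsmooth : ContMDiff (𝓘(ℝ, F).prod 𝓘(ℝ, K)) 𝓘(ℝ, E) ∞ (ι ∘ fun q : G × S => f q.1 q.2) := by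
    rw [show ι ∘ (fun q : G × S => f q.1 q.2) = fun q => A'.act q.1 (ι q.2) from
      funext fun q => hf q.1 q.2]
    exact A'.smooth.comp (contMDiff_fst.prodMk (hι.embedding.contMDiff.comp contMDiff_snd))
  refine ⟨⟨f, fun s => hinj (by rw [hf, A'.one_act]),
    fun a b s => hinj (by rw [hf, hf, hf, A'.mul_act]), ?_⟩, hf⟩
  exact (ContMDiff.iff_comp_isImmersion hι.embedding.isImmersion).2
    ⟨hι.embedding.isEmbedding.continuous_iff.2 hsmooth.continuous, hsmooth⟩

end Restrict

/-! ### The covariant derivative of the complex structure -/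

section LeviCivita

variable {E : Type*} [NormedAddCommGroup E] [NormedSpace ℝ E]
  {M : Type*} [TopologicalSpace M] [ChartedSpace E M] [IsManifold 𝓘(ℝ, E) ∞ M]
  {D : CovariantDerivative 𝓘(ℝ, E) E (fun x : M => TangentSpace 𝓘(ℝ, E) x)}
  {J : EndField E M} {θ : OneForm E M}

/-- The covariant derivative `(D_v J) Y` of a field of endomorphisms `J`. -/
noncomputable def derivEndField
    (D : CovariantDerivative 𝓘(ℝ, E) E (fun x : M => TangentSpace 𝓘(ℝ, E) x)) (J : EndField E M)
    (Y : VField E M) (x : M) (v : TangentSpace 𝓘(ℝ, E) x) :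
    TangentSpace 𝓘(ℝ, E) x :=
  D (fun y => J y (Y y)) x v - J x (D Y x v)

lemma covariantDerivative_neg {Y : VField E M} {x : M} (hY : Y.DiffAt x)
    (v : TangentSpace 𝓘(ℝ, E) x) : D (fun y => -Y y) x v = -D Y x v := by
  have hneg : ((-1 : ℝ) • Y) = fun y => -Y y := funext fun y => neg_one_smul ℝ (Y y)
  rw [← hneg, (D.isCovariantDerivativeOn (s := Set.univ)).smul_const (-1 : ℝ) hY, neg_one_smul]
  rfl

lemma derivEndField_comp (hJ : IsComplexStructure J) {Y : VField E M} {x : M} (hY : Y.DiffAt x)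
    (v : TangentSpace 𝓘(ℝ, E) x) :
    derivEndField D J (fun y => J y (Y y)) x v = -J x (derivEndField D J Y x v) := by
  unfold derivEndField
  have hsq : (fun y => J y (J y (Y y))) = fun y => -Y y := funext fun y => hJ.sq_eq_neg y _
  rw [hsq, covariantDerivative_neg hY, map_sub, hJ.sq_eq_neg]
  abel

variable [Bundle.RiemannianBundle (fun x : M => TangentSpace 𝓘(ℝ, E) x)]

lemma IsLCK.inner_endField_left (hM : IsLCK J θ) (x : M) (u v : TangentSpace 𝓘(ℝ, E) x) :
    inner ℝ (J x u) v = -inner ℝ u (J x v) := by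
  rw [← hM.hermitian x (J x u) v, hM.complex.sq_eq_neg, inner_neg_left]

lemma IsLeviCivita.mvfderiv_fundamentalForm (hD : IsLeviCivita D) (hM : IsLCK J θ)
    {Y Z : VField E M} {x : M}
    (hY : Y.DiffAt x) (hZ : Z.DiffAt x) (v : TangentSpace 𝓘(ℝ, E) x) :
    mvfderiv 𝓘(ℝ, E) (fun y => fundamentalForm J y (Y y) (Z y)) x v
      = inner ℝ (derivEndField D J Y x v) (Z x) + inner ℝ (J x (D Y x v)) (Z x)
        + inner ℝ (J x (Y x)) (D Z x v) := by
  unfold fundamentalForm derivEndField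
  rw [hD.metric x v _ Z (hM.complex.smooth.diffAt hY) hZ, inner_sub_left]
  ring

lemma IsLeviCivita.nijenhuis_eq (hD : IsLeviCivita D) (hM : IsLCK J θ)
    {Y Z : VField E M} {x : M} (hY : Y.DiffAt x) (hZ : Z.DiffAt x) :
    derivEndField D J Z x (J x (Y x)) - derivEndField D J Y x (J x (Z x))
      + J x (derivEndField D J Y x (Z x)) - J x (derivEndField D J Z x (Y x)) = 0 := by
  have hJY := hM.complex.smooth.diffAt hY
  have hJZ := hM.complex.smooth.diffAt hZ
  have hnijenhuis := hM.complex.nijenhuis x Y Z hY hZ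
  rw [← hD.torsionFree x _ _ hJY hJZ, ← hD.torsionFree x _ _ hJY hZ,
    ← hD.torsionFree x _ _ hY hJZ, ← hD.torsionFree x _ _ hY hZ] at hnijenhuis
  rw [← hnijenhuis]
  unfold derivEndField
  simp only [map_sub, hM.complex.sq_eq_neg]
  abel

lemma IsLeviCivita.inner_derivEndField_swap (hD : IsLeviCivita D) (hM : IsLCK J θ)
    {Y Z : VField E M} {x : M}
    (hY : Y.DiffAt x) (hZ : Z.DiffAt x) (v : TangentSpace 𝓘(ℝ, E) x) :
    inner ℝ (derivEndField D J Z x v) (Y x) = -inner ℝ (derivEndField D J Y x v) (Z x) := by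
  have hskew : (fun y => fundamentalForm J y (Z y) (Y y))
      = fun y => -fundamentalForm J y (Y y) (Z y) := by
    ext y
    unfold fundamentalForm
    rw [hM.inner_endField_left, real_inner_comm]
  have hderiv : mvfderiv 𝓘(ℝ, E) (fun y => fundamentalForm J y (Z y) (Y y)) x v
      = -mvfderiv 𝓘(ℝ, E) (fun y => fundamentalForm J y (Y y) (Z y)) x v := by
    rw [hskew, mvfderiv_fun_neg]
    rfl
  rw [hD.mvfderiv_fundamentalForm hM hY hZ, hD.mvfderiv_fundamentalForm hM hZ hY,
    hM.inner_endField_left x (D Y x v), hM.inner_endField_left x (D Z x v),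
    real_inner_comm (D Y x v), real_inner_comm (D Z x v)] at hderiv
  linarith

lemma IsLeviCivita.extDerivTwoForm_fundamentalForm (hD : IsLeviCivita D) (hM : IsLCK J θ)
    {X Y Z : VField E M} {x : M} (hX : X.DiffAt x) (hY : Y.DiffAt x) (hZ : Z.DiffAt x) :
    extDerivTwoForm (fundamentalForm J) X Y Z x
      = inner ℝ (derivEndField D J Y x (X x)) (Z x)
        + inner ℝ (derivEndField D J Z x (Y x)) (X x)
        + inner ℝ (derivEndField D J X x (Z x)) (Y x) := by
  unfold extDerivTwoForm
  rw [hD.mvfderiv_fundamentalForm hM hY hZ, hD.mvfderiv_fundamentalForm hM hX hZ,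
    hD.mvfderiv_fundamentalForm hM hX hY, ← hD.torsionFree x X Y hX hY,
    ← hD.torsionFree x X Z hX hZ, ← hD.torsionFree x Y Z hY hZ]
  have hswap := hD.inner_derivEndField_swap hM hX hZ (Y x)
  have hskew : ∀ u v, inner ℝ (J x u) v = -inner ℝ (J x v) u := fun u v => by
    rw [hM.inner_endField_left, real_inner_comm]
  unfold fundamentalForm
  simp only [map_sub, inner_sub_left]
  rw [hskew (Y x) (D Z x (X x)), hskew (X x) (D Z x (Y x)), hskew (X x) (D Y x (Z x))]
  linarith

lemma IsLeviCivita.two_inner_derivEndField (hD : IsLeviCivita D) (hM : IsLCK J θ)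
    {X Y Z : VField E M} {x : M} (hX : X.DiffAt x) (hY : Y.DiffAt x) (hZ : Z.DiffAt x) :
    2 * inner ℝ (derivEndField D J Y x (X x)) (Z x)
      = extDerivTwoForm (fundamentalForm J) X Y Z x
        - extDerivTwoForm (fundamentalForm J) X (fun y => J y (Y y)) (fun y => J y (Z y)) x := by
  have hJX := hM.complex.smooth.diffAt hX
  have hJY := hM.complex.smooth.diffAt hY
  have hJZ := hM.complex.smooth.diffAt hZ
  rw [hD.extDerivTwoForm_fundamentalForm hM hX hY hZ,
    hD.extDerivTwoForm_fundamentalForm hM hX hJY hJZ,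
    derivEndField_comp hM.complex hY, derivEndField_comp hM.complex hZ]
  have hnijenhuis := congrArg (fun w => inner ℝ w (J x (X x))) (hD.nijenhuis_eq hM hY hZ)
  simp only [inner_add_left, inner_sub_left, inner_zero_left, hM.hermitian] at hnijenhuis
  have hswap := hD.inner_derivEndField_swap hM hY hJX (J x (Z x))
  rw [derivEndField_comp hM.complex hX, inner_neg_left, hM.inner_endField_left] at hswap
  simp only [inner_neg_left, hM.hermitian]
  linarith [hD.inner_derivEndField_swap hM hX hY (Z x),
    hM.inner_endField_left x (derivEndField D J Z x (J x (Y x))) (X x)]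

end LeviCivita

/-! ### The moment map of a Vaisman manifold -/

section Vaisman

variable {E : Type*} [NormedAddCommGroup E] [NormedSpace ℝ E]
  {M : Type*} [TopologicalSpace M] [ChartedSpace E M] [IsManifold 𝓘(ℝ, E) ∞ M]
  [Bundle.RiemannianBundle (fun x : M => TangentSpace 𝓘(ℝ, E) x)]
  {J : EndField E M} {θ : OneForm E M}

/- With `f` a local primitive of `θ`, the function `e^{-f} k` is locally constant. -/
lemma IsLCK.isLocallyConstant_eq_zero (hM : IsLCK J θ) {k : M → ℝ}
    (hk : MDifferentiable 𝓘(ℝ, E) 𝓘(ℝ, ℝ) k)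
    (hdk : ∀ x v, mvfderiv 𝓘(ℝ, E) k x v = k x * θ x v) : IsLocallyConstant (k · = 0) := by
  have : IsManifold 𝓘(ℝ, E) 1 M := inferInstance
  refine (IsLocallyConstant.iff_eventually_eq _).2 fun x => ?_
  obtain ⟨f, hf, hfθ⟩ := hM.exists_primitive x
  have hfd : ∀ᶠ y in 𝓝 x, MDifferentiableAt 𝓘(ℝ, E) 𝓘(ℝ, ℝ) f y :=
    ((contMDiffAt_iff_contMDiffAt_nhds (by simp)).1 (hf.of_le (m := 1) (by simp))).mono
      fun y hy => hy.mdifferentiableAt one_ne_zero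
  have hconst : ∀ᶠ y in 𝓝 x, Real.exp (-f y) * k y = Real.exp (-f x) * k x := by
    refine eventually_eq_of_eventually_mvfderiv_eq_zero (I := 𝓘(ℝ, E)) ?_
    filter_upwards [hfd, hfθ] with y hy hyθ
    have hexp : MDifferentiableAt 𝓘(ℝ, E) 𝓘(ℝ, ℝ) (fun z => Real.exp (-f z)) y :=
      Real.differentiableAt_exp.mdifferentiableAt.comp y hy.neg
    refine ⟨hexp.mul (hk y), ?_⟩
    ext v
    rw [mvfderiv_exp_neg_mul hy (hk y), hdk, hyθ, mul_comm (k y), sub_self, mul_zero]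
    rfl
  filter_upwards [hconst] with y hy
  rw [← mul_eq_zero_iff_left (Real.exp_pos (-f y)).ne', hy,
    mul_eq_zero_iff_left (Real.exp_pos (-f x)).ne']

/- Where `k ≠ 0`, the equation says `θ = d log k`. -/
lemma eq_zero_of_mvfderiv_eq_smul [PreconnectedSpace M] (hM : IsLCK J θ)
    (hex : ¬IsExactOneForm θ) {k : M → ℝ} (hk : ContMDiff 𝓘(ℝ, E) 𝓘(ℝ, ℝ) ∞ k)
    (hdk : ∀ x v, mvfderiv 𝓘(ℝ, E) k x v = k x * θ x v) (x : M) : k x = 0 := by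
  have hkd : MDifferentiable 𝓘(ℝ, E) 𝓘(ℝ, ℝ) k := hk.mdifferentiable (by simp)
  by_contra hx
  have hne (y : M) : k y ≠ 0 := fun hy => hx
    ((hM.isLocallyConstant_eq_zero hkd hdk).apply_eq_of_preconnectedSpace x y ▸ hy)
  refine hex ⟨fun y => Real.log (k y), fun y =>
    (Real.contDiffAt_log.2 (hne y)).contMDiffAt.comp y (hk y), fun y => ?_⟩
  ext v
  rw [mvfderiv_real_comp (Real.hasDerivAt_log (hne y)) (hkd y), hdk, inv_mul_cancel_left₀ (hne y)]

end Vaisman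

section LeeField

variable {E : Type*} [NormedAddCommGroup E] [NormedSpace ℝ E] [FiniteDimensional ℝ E]
  {M : Type*} [TopologicalSpace M] [ChartedSpace E M] [IsManifold 𝓘(ℝ, E) ∞ M]
  [Bundle.RiemannianBundle (fun x : M => TangentSpace 𝓘(ℝ, E) x)]
  {D : CovariantDerivative 𝓘(ℝ, E) E (fun x : M => TangentSpace 𝓘(ℝ, E) x)}
  {J : EndField E M} {θ : OneForm E M}

lemma IsVaisman.lee_sharp (hM : IsVaisman J θ) (x : M) : θ x (sharp θ x) = 1 := by
  rw [← inner_sharp, real_inner_self_eq_norm_sq, norm_sharp, hM.unit_length, one_pow]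

lemma IsLeviCivita.mvfderiv_mvfderiv_sub_comm (hD : IsLeviCivita D) {u : M → ℝ} {x : M}
    (hu : ContMDiffAt 𝓘(ℝ, E) 𝓘(ℝ, ℝ) 2 u x) {X Y : VField E M} (hX : X.DiffAt x)
    (hY : Y.DiffAt x) :
    mvfderiv 𝓘(ℝ, E) (fun y => mvfderiv 𝓘(ℝ, E) u y (Y y)) x (X x)
        - mvfderiv 𝓘(ℝ, E) u x (D Y x (X x))
      = mvfderiv 𝓘(ℝ, E) (fun y => mvfderiv 𝓘(ℝ, E) u y (X y)) x (Y x)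
        - mvfderiv 𝓘(ℝ, E) u x (D X x (Y x)) := by
  have : CompleteSpace E := FiniteDimensional.complete ℝ E
  have hbracket := mvfderiv_mlieBracket hu hX hY
  rw [← hD.torsionFree x X Y hX hY, map_sub] at hbracket
  linarith

variable [IsContMDiffRiemannianBundle 𝓘(ℝ, E) ∞ E (fun x : M => TangentSpace 𝓘(ℝ, E) x)]

lemma IsLCK.sharp_diffAt (hM : IsLCK J θ) (x : M) : (sharp θ).DiffAt x :=
  (sharp_smoothAt (hM.smoothAt x)).diffAt

lemma IsLeviCivita.covariantDerivative_sharp (hD : IsLeviCivita D) (hM : IsLCK J θ)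
    (hθ : ∀ (x : M) (v : TangentSpace 𝓘(ℝ, E) x) (Y : VField E M), Y.DiffAt x →
      mvfderiv 𝓘(ℝ, E) (fun y => θ y (Y y)) x v - θ x (D Y x v) = 0)
    (x : M) (v : TangentSpace 𝓘(ℝ, E) x) : D (sharp θ) x v = 0 := by
  refine ext_inner_right ℝ fun w => ?_
  obtain ⟨Y, hY, rfl⟩ := exists_smoothAt_eq x w
  have hmetric := hD.metric x v (sharp θ) Y (hM.sharp_diffAt x) hY.diffAt
  simp only [inner_sharp] at hmetric
  rw [inner_zero_left]
  linarith [hθ x v Y hY.diffAt]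

lemma IsLeviCivita.derivEndField_sharp (hD : IsLeviCivita D) (hM : IsLCK J θ)
    {Y : VField E M} {x : M} (hY : Y.DiffAt x) : derivEndField D J Y x (sharp θ x) = 0 := by
  refine ext_inner_right ℝ fun w => ?_
  obtain ⟨Z, hZ, rfl⟩ := exists_smoothAt_eq x w
  have hB := hM.sharp_diffAt x
  have hDJ := hD.two_inner_derivEndField hM hB hY hZ.diffAt
  rw [hM.extDerivTwoForm_fundamentalForm hB hY hZ.diffAt,
    hM.extDerivTwoForm_fundamentalForm hB (hM.complex.smooth.diffAt hY)
      (hM.complex.smooth.diffAt hZ.diffAt)] at hDJ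
  simp only [fundamentalForm, hM.hermitian, hM.inner_endField_left x (sharp θ x),
    inner_sharp] at hDJ
  rw [inner_zero_left]
  linarith

end LeeField

section MomentMap

variable {F : Type*} [NormedAddCommGroup F] [NormedSpace ℝ F]
  {G : Type*} [TopologicalSpace G] [ChartedSpace F G] [Group G]
  {E : Type*} [NormedAddCommGroup E] [NormedSpace ℝ E] [FiniteDimensional ℝ E]
  {M : Type*} [TopologicalSpace M] [ChartedSpace E M] [IsManifold 𝓘(ℝ, E) ∞ M]
  [Bundle.RiemannianBundle (fun x : M => TangentSpace 𝓘(ℝ, E) x)]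
  [IsContMDiffRiemannianBundle 𝓘(ℝ, E) ∞ E (fun x : M => TangentSpace 𝓘(ℝ, E) x)]
  {J : EndField E M} {θ : OneForm E M} {A : SmoothAction F G E M}

lemma SmoothAction.ByVaismanAutomorphisms.mfderiv_sharp (hA : A.ByVaismanAutomorphisms J)
    (hM : IsLCK J θ) (a : G) (x : M) :
    mfderiv 𝓘(ℝ, E) 𝓘(ℝ, E) (A.act a) x (sharp θ x) = sharp θ (A.act a x) := by
  refine ext_inner_right ℝ fun w => ?_
  obtain ⟨v, rfl⟩ := (A.isInvertible_mfderiv a x).bijective.surjective w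
  rw [hA.isometric, inner_sharp, inner_sharp, hA.lee_mfderiv hM]

variable [IsManifold 𝓘(ℝ, F) ∞ G]
  {D : CovariantDerivative 𝓘(ℝ, E) E (fun x : M => TangentSpace 𝓘(ℝ, E) x)}
  {μ : M → LieDual F G}

/- `D_B X̄ = [B, X̄] + D_X̄ B`, and both terms vanish for an invariant parallel field `B`. -/
lemma SmoothAction.ByVaismanAutomorphisms.covariantDerivative_endField_fundamental
    (hA : A.ByVaismanAutomorphisms J) (hM : IsLCK J θ) (hD : IsLeviCivita D)
    (hB : ∀ x v, D (sharp θ) x v = 0) (X : GroupLieAlgebra 𝓘(ℝ, F) G) (x : M) :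
    D (fun y => J y (A.fundamental y X)) x (sharp θ x) = 0 := by
  have : CompleteSpace E := FiniteDimensional.complete ℝ E
  have hX := (A.fundamental_smoothAt X x).diffAt
  have htorsion := hD.torsionFree x _ _ hX (hM.sharp_diffAt x)
  rw [hB, A.mlieBracket_fundamental_eq_zero (hM.sharp_diffAt x)
    (fun a => hA.mfderiv_sharp hM a x), zero_sub, neg_eq_zero] at htorsion
  have hDJ := hD.derivEndField_sharp hM hX
  rwa [derivEndField, htorsion, map_zero, sub_zero] at hDJ

lemma IsTwistedMomentMap.mvfderiv_mvfderiv_sharp (hμ : IsTwistedMomentMap J θ A μ)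
    (hA : A.ByVaismanAutomorphisms J) (hM : IsLCK J θ) (hD : IsLeviCivita D)
    (hB : ∀ x v, D (sharp θ) x v = 0) (X : GroupLieAlgebra 𝓘(ℝ, F) G) (x : M)
    (v : TangentSpace 𝓘(ℝ, E) x) :
    mvfderiv 𝓘(ℝ, E) (fun y => mvfderiv 𝓘(ℝ, E) (fun z => μ z X) y (sharp θ y)) x v
      = mvfderiv 𝓘(ℝ, E) (fun z => μ z X) x (sharp θ x) * θ x v := by
  obtain ⟨V, hV, rfl⟩ := exists_smoothAt_eq x v
  have hV := hV.diffAt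
  have hJX := hM.complex.smooth.diffAt (A.fundamental_smoothAt X x).diffAt
  have hμx : MDifferentiableAt 𝓘(ℝ, E) 𝓘(ℝ, ℝ) (fun z => μ z X) x :=
    (hμ.smooth X).mdifferentiableAt (by simp)
  have hθV : MDifferentiableAt 𝓘(ℝ, E) 𝓘(ℝ, ℝ) (fun z => θ z (V z)) x :=
    (hM.smoothAt x).mdifferentiableAt hV
  have hDθ := hD.metric x (sharp θ x) (sharp θ) V (hM.sharp_diffAt x) hV
  simp only [inner_sharp, hB, inner_zero_left, zero_add] at hDθ
  have hdμ (z : M) (w : TangentSpace 𝓘(ℝ, E) z) : mvfderiv 𝓘(ℝ, E) (fun z => μ z X) z w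
      = μ z X * θ z w + inner ℝ (J z (A.fundamental z X)) w :=
    eq_add_of_sub_eq' (hμ.eq X z w)
  have hderiv : mvfderiv 𝓘(ℝ, E) (fun z => mvfderiv 𝓘(ℝ, E) (fun z => μ z X) z (V z)) x
        (sharp θ x)
      = mvfderiv 𝓘(ℝ, E) (fun z => μ z X) x (sharp θ x) * θ x (V x)
        + mvfderiv 𝓘(ℝ, E) (fun z => μ z X) x (D V x (sharp θ x)) := by
    simp only [hdμ _ (V _)]
    have hmul : MDifferentiableAt 𝓘(ℝ, E) 𝓘(ℝ, ℝ) (fun z => μ z X * θ z (V z)) x := hμx.mul hθV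
    rw [mvfderiv_fun_add hmul (MDifferentiableAt.inner_bundle
      (E := fun y : M => TangentSpace 𝓘(ℝ, E) y) hJX hV), mvfderiv_fun_mul hμx hθV]
    simp only [add_apply, smul_apply, smul_eq_mul]
    rw [hD.metric x _ _ V hJX hV, hA.covariantDerivative_endField_fundamental hM hD hB,
      inner_zero_left, hdμ x (D V x (sharp θ x)), hDθ]
    ring
  have hcomm := hD.mvfderiv_mvfderiv_sub_comm ((hμ.smooth X x).of_le ENat.LEInfty.out) hV
    (hM.sharp_diffAt x)
  rw [hB, map_zero, sub_zero, hderiv, add_sub_cancel_right] at hcomm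
  exact hcomm

lemma IsTwistedMomentMap.mvfderiv_sharp_eq_zero [PreconnectedSpace M]
    (hμ : IsTwistedMomentMap J θ A μ) (hA : A.ByVaismanAutomorphisms J) (hM : IsVaisman J θ)
    (X : GroupLieAlgebra 𝓘(ℝ, F) G) (x : M) :
    mvfderiv 𝓘(ℝ, E) (fun y => μ y X) x (sharp θ x) = 0 := by
  obtain ⟨D, hD, hθ⟩ := hM.parallel
  have hL := hM.toIsLCK
  refine eq_zero_of_mvfderiv_eq_smul hL hM.strict (fun y => ?_)
    (hμ.mvfderiv_mvfderiv_sharp hA hL hD (hD.covariantDerivative_sharp hL hθ) X) x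
  exact (OneForm.smoothAt_of_eventually_mvfderiv_eq (hμ.smooth X y)
    (.of_forall fun _ => rfl)).contMDiffAt (sharp_smoothAt (hL.smoothAt y))

lemma IsTwistedMomentMap.apply_eq [PreconnectedSpace M] (hμ : IsTwistedMomentMap J θ A μ)
    (hA : A.ByVaismanAutomorphisms J) (hM : IsVaisman J θ) (X : GroupLieAlgebra 𝓘(ℝ, F) G)
    (x : M) : μ x X = -θ x (J x (A.fundamental x X)) := by
  have hdμ := hμ.eq X x (sharp θ x)
  rw [hμ.mvfderiv_sharp_eq_zero hA hM, hM.lee_sharp, fundamentalForm, real_inner_comm,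
    inner_sharp] at hdμ
  linarith

end MomentMap

/-! ### Completeness of bounded vector fields -/

section LocalFlow

open Set

variable {E : Type*} [NormedAddCommGroup E] [NormedSpace ℝ E]

lemma exists_eventually_exists_hasDerivAt_mem [CompleteSpace E] {w : E → E} {z₀ : E}
    (hw : ContDiffAt ℝ 1 w z₀) {U : Set E} (hU : U ∈ 𝓝 z₀) :
    ∃ ε > 0, ∀ᶠ z in 𝓝 z₀, ∃ f : ℝ → E, f 0 = z ∧
      ∀ t ∈ Ioo (-ε) ε, HasDerivAt f (w (f t)) t ∧ f t ∈ U := by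
  obtain ⟨ε, hε, _, r, _, _, hr, hw⟩ := IsPicardLindelof.of_contDiffAt_one hw
  obtain ⟨Ψ, hΨ, hcont⟩ := (hw 0).exists_forall_mem_closedBall_eq_hasDerivWithinAt_continuousOn
  simp only [zero_sub, zero_add] at hΨ hcont
  have hball : Metric.closedBall z₀ r ∈ 𝓝 z₀ := Metric.closedBall_mem_nhds z₀ hr
  have hmem : ∀ᶠ q : E × ℝ in 𝓝 (z₀, 0), Ψ q ∈ U := by
    refine (hcont.continuousAt
      (prod_mem_nhds hball (Icc_mem_nhds (neg_lt_zero.2 hε) hε))).eventually ?_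
    rwa [(hΨ z₀ (mem_of_mem_nhds hball)).1]
  rw [nhds_prod_eq] at hmem
  obtain ⟨pz, hpz, pt, hpt, hU⟩ := Filter.eventually_prod_iff.1 hmem
  obtain ⟨δ, hδ, hδt⟩ := Metric.eventually_nhds_iff_ball.1 hpt
  refine ⟨min ε δ, lt_min hε hδ, ?_⟩
  filter_upwards [hpz, hball] with z hz hzr
  refine ⟨fun t => Ψ (z, t), (hΨ z hzr).1, fun t ht => ⟨?_, hU hz (hδt t ?_)⟩⟩
  · have htε : t ∈ Ioo (-ε) ε := Ioo_subset_Ioo (neg_le_neg (min_le_left ..)) (min_le_left ..) ht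
    exact ((hΨ z hzr).2 t (Ioo_subset_Icc_self htε)).hasDerivAt (Icc_mem_nhds htε.1 htε.2)
  · rw [Real.ball_eq_Ioo, zero_sub, zero_add]
    exact Ioo_subset_Ioo (neg_le_neg (min_le_right ..)) (min_le_right ..) ht

variable {M : Type*} [TopologicalSpace M] [ChartedSpace E M] {v : VField E M} {γ : ℝ → M}

lemma VField.contDiffAt_inChart [CompleteSpace E] [IsManifold 𝓘(ℝ, E) ∞ M] {x : M}
    (hv : ContMDiffAt 𝓘(ℝ, E) (𝓘(ℝ, E).prod 𝓘(ℝ, E)) 1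
      (fun y => (⟨y, v y⟩ : TangentBundle 𝓘(ℝ, E) M)) x) :
    ContDiffAt ℝ 1 (v.inChart x) (extChartAt 𝓘(ℝ, E) x x) := by
  have : IsManifold 𝓘(ℝ, E) (minSmoothness ℝ 2) M := by
    rw [minSmoothness_of_isRCLikeNormedField]; infer_instance
  obtain ⟨hφ, hinv⟩ :=
    (eventually_contMDiffAt_isInvertible_extChartAt_symm (E := E) x).self_of_nhds
  rw [← extChartAt_to_inv (I := 𝓘(ℝ, E)) x] at hv
  have htwo : (1 : WithTop ℕ∞) + 1 ≤ ∞ := by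
    rw [one_add_one_eq_two]
    exact ENat.LEInfty.out
  exact contMDiffAt_vectorSpace_iff_contDiffAt.1
    (hv.mpullback_vectorField_preimage hφ hinv htwo)

lemma exists_eventually_exists_isMIntegralCurveOn [CompleteSpace E] [IsManifold 𝓘(ℝ, E) ∞ M]
    {x : M} (hv : ContMDiffAt 𝓘(ℝ, E) (𝓘(ℝ, E).prod 𝓘(ℝ, E)) 1
      (fun y => (⟨y, v y⟩ : TangentBundle 𝓘(ℝ, E) M)) x) :
    ∃ ε > 0, ∀ᶠ y in 𝓝 x, ∃ γ : ℝ → M, γ 0 = y ∧ IsMIntegralCurveOn γ v (Ioo (-ε) ε) := by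
  obtain ⟨ε, hε, hflow⟩ := exists_eventually_exists_hasDerivAt_mem
    (VField.contDiffAt_inChart hv) (eventually_contMDiffAt_isInvertible_extChartAt_symm x)
  refine ⟨ε, hε, ?_⟩
  filter_upwards [(continuousAt_extChartAt (I := 𝓘(ℝ, E)) x).eventually hflow,
    extChartAt_source_mem_nhds (I := 𝓘(ℝ, E)) x] with y ⟨f, hf₀, hf⟩ hy
  refine ⟨(extChartAt 𝓘(ℝ, E) x).symm ∘ f, ?_, fun t ht => ?_⟩
  · rw [Function.comp_apply, hf₀, (extChartAt 𝓘(ℝ, E) x).left_inv hy]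
  obtain ⟨hft, hφ, hinv⟩ := hf t ht
  have hγ := ((hφ.mdifferentiableAt (by simp)).hasMFDerivAt.comp t
    hft.hasFDerivAt.hasMFDerivAt).hasMFDerivWithinAt (s := Ioo (-ε) ε)
  refine hγ.congr_mfderiv (ContinuousLinearMap.ext_ring ?_)
  change mfderiv 𝓘(ℝ, E) 𝓘(ℝ, E) (extChartAt 𝓘(ℝ, E) x).symm (f t) ((1 : ℝ) • v.inChart x (f t))
    = (1 : ℝ) • v ((extChartAt 𝓘(ℝ, E) x).symm (f t))
  rw [one_smul, one_smul]
  exact hinv.self_apply_inverse _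

end LocalFlow

section IntegralCurves

open Set

variable {E : Type*} [NormedAddCommGroup E] [NormedSpace ℝ E]
  {M : Type*} [TopologicalSpace M] [ChartedSpace E M] {v : VField E M} {γ : ℝ → M}

lemma continuousOn_tangentCoordChange_apply [IsManifold 𝓘(ℝ, E) 1 M]
    (hv : Continuous (fun x => (⟨x, v x⟩ : TangentBundle 𝓘(ℝ, E) M))) (x₀ : M) :
    ContinuousOn (fun x => tangentCoordChange 𝓘(ℝ, E) x x₀ x (v x)) (chartAt E x₀).source := by
  refine continuous_snd.comp_continuousOn
    ((trivializationAt E (TangentSpace 𝓘(ℝ, E)) x₀).continuousOn_toFun.comp hv.continuousOn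
      fun x hx => ?_)
  rw [Bundle.Trivialization.source_eq]
  exact hx

lemma contMDiffAt_of_isMIntegralCurveAt [IsManifold 𝓘(ℝ, E) 1 M]
    (hv : Continuous (fun x => (⟨x, v x⟩ : TangentBundle 𝓘(ℝ, E) M))) {t₀ : ℝ}
    (hγ : IsMIntegralCurveAt γ v t₀) : ContMDiffAt 𝓘(ℝ, ℝ) 𝓘(ℝ, E) 1 γ t₀ := by
  rw [contMDiffAt_iff, modelWithCornersSelf_coe, range_id, contDiffWithinAt_univ]
  refine ⟨hγ.continuousAt, ?_⟩
  have hsrc : ∀ᶠ t in 𝓝 t₀, γ t ∈ (chartAt E (γ t₀)).source :=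
    hγ.continuousAt.eventually ((chartAt E (γ t₀)).open_source.mem_nhds (mem_chart_source E _))
  obtain ⟨u, hu, hγu⟩ := (hγ.eventually_hasDerivAt.and (hsrc.and
    (hγ.mono fun t ht => ht.continuousAt))).exists_mem
  have hcont : ContinuousOn
      (fun t => tangentCoordChange 𝓘(ℝ, E) (γ t) (γ t₀) (γ t) (v (γ t))) u :=
    (continuousOn_tangentCoordChange_apply hv (γ t₀)).comp
      (fun t ht => (hγu t ht).2.2.continuousWithinAt) (fun t ht => (hγu t ht).2.1)
  have hC := contDiffAt_one_iff.2 ⟨fun t => ContinuousLinearMap.toSpanSingleton ℝ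
    (tangentCoordChange 𝓘(ℝ, E) (γ t) (γ t₀) (γ t) (v (γ t))), u, hu,
    (ContinuousLinearMap.toSpanSingletonLIE ℝ E).continuous.comp_continuousOn hcont,
    fun t ht => (hγu t ht).1.hasFDerivAt⟩
  exact hC

lemma mfderiv_of_isMIntegralCurveAt {t : ℝ} (hγ : IsMIntegralCurveAt γ v t) (r : ℝ) :
    mfderiv 𝓘(ℝ, ℝ) 𝓘(ℝ, E) γ t r = r • v (γ t) :=
  DFunLike.congr_fun hγ.hasMFDerivAt.mfderiv r

end IntegralCurves

section Complete

open Set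

variable {E : Type*} [NormedAddCommGroup E] [NormedSpace ℝ E]
  {M : Type*} [MetricSpace M] [ChartedSpace E M] {v : VField E M} {γ : ℝ → M}

lemma lipschitzOnWith_of_isMIntegralCurveOn [IsManifold 𝓘(ℝ, E) 1 M]
    [Bundle.RiemannianBundle (fun x : M => TangentSpace 𝓘(ℝ, E) x)]
    [IsRiemannianManifold 𝓘(ℝ, E) M]
    (hv : Continuous (fun x => (⟨x, v x⟩ : TangentBundle 𝓘(ℝ, E) M)))
    {C : NNReal} (hvC : ∀ x, ‖v x‖ₑ ≤ C) {a b : ℝ} (hγ : IsMIntegralCurveOn γ v (Ioo a b)) :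
    LipschitzOnWith C γ (Ioo a b) := by
  have hle : ∀ s ∈ Ioo a b, ∀ t ∈ Ioo a b, s ≤ t → edist (γ s) (γ t) ≤ C * edist s t := by
    intro s hs t ht hst
    have hat : ∀ r ∈ Icc s t, IsMIntegralCurveAt γ v r := fun r hr =>
      hγ.isMIntegralCurveAt (Ioo_mem_nhds (hs.1.trans_le hr.1) (hr.2.trans_lt ht.2))
    calc edist (γ s) (γ t)
        = Manifold.riemannianEDist 𝓘(ℝ, E) (γ s) (γ t) :=
          IsRiemannianManifold.out (I := 𝓘(ℝ, E)) (γ s) (γ t)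
      _ ≤ Manifold.pathELength 𝓘(ℝ, E) γ s t :=
          Manifold.riemannianEDist_le_pathELength (fun r hr =>
            (contMDiffAt_of_isMIntegralCurveAt hv (hat r hr)).contMDiffWithinAt) rfl rfl hst
      _ = ∫⁻ r in Icc s t, ‖mfderiv 𝓘(ℝ, ℝ) 𝓘(ℝ, E) γ r (1 : ℝ)‖ₑ :=
          Manifold.pathELength_eq_lintegral_mfderiv_Icc
      _ ≤ ∫⁻ _ in Icc s t, C :=
          MeasureTheory.setLIntegral_mono' measurableSet_Icc fun r hr =>
            (congrArg _ ((mfderiv_of_isMIntegralCurveAt (hat r hr) 1).trans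
              (one_smul ℝ (v (γ r))))).trans_le (hvC (γ r))
      _ = C * edist s t := by
          rw [MeasureTheory.setLIntegral_const, Real.volume_Icc, edist_dist, Real.dist_eq,
            abs_sub_comm, abs_of_nonneg (sub_nonneg.2 hst)]
  intro s hs t ht
  rcases le_total s t with hst | hts
  · exact hle s hs t ht hst
  · rw [edist_comm, edist_comm s]
    exact hle t ht s hs hts

lemma exists_tendsto_nhdsLT_of_lipschitzOnWith {X : Type*} [PseudoEMetricSpace X]
    [CompleteSpace X] {f : ℝ → X} {C : NNReal} {a b : ℝ} (hab : a < b)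
    (hf : LipschitzOnWith C f (Ioo a b)) : ∃ y, Filter.Tendsto f (𝓝[<] b) (𝓝 y) := by
  rw [← nhdsWithin_Ioo_eq_nhdsLT hab]
  have hb : Cauchy (𝓝[Ioo a b] b) := cauchy_nhds.mono' (right_nhdsWithin_Ioo_neBot hab) inf_le_left
  have : (𝓝[Ioo a b] b).NeBot := hb.1
  exact cauchy_map_iff_exists_tendsto.1 (hb.map_of_le hf.uniformContinuousOn inf_le_right)

lemma exists_isMIntegralCurveOn_right [CompleteSpace E] [IsManifold 𝓘(ℝ, E) ∞ M]
    (hv : ContMDiff 𝓘(ℝ, E) (𝓘(ℝ, E).prod 𝓘(ℝ, E)) 1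
      (fun x => (⟨x, v x⟩ : TangentBundle 𝓘(ℝ, E) M))) {a b : ℝ} (hab : a < b)
    (hγ : IsMIntegralCurveOn γ v (Ioo a b)) {y : M} (hy : Filter.Tendsto γ (𝓝[<] b) (𝓝 y)) :
    ∃ γ' : ℝ → M, ∃ ε > 0, EqOn γ' γ (Ioo a b) ∧ IsMIntegralCurveOn γ' v (Ioo a (b + ε)) := by
  have : IsManifold 𝓘(ℝ, E) 1 M := inferInstance
  obtain ⟨ε, hε, hflow⟩ := exists_eventually_exists_isMIntegralCurveOn (hv y)
  obtain ⟨t₀, ⟨hat₀, ht₀b⟩, σ, hσ₀, hσ⟩ :=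
    (Filter.Eventually.and (Ioo_mem_nhdsLT (max_lt hab (sub_lt_self b hε)))
      (hy.eventually hflow)).exists
  obtain ⟨hat₀, hbt₀⟩ := max_lt_iff.1 hat₀
  have hσ' : IsMIntegralCurveOn (σ ∘ (· - t₀)) v (Ioo (t₀ - ε) (t₀ + ε)) := by
    convert isMIntegralCurveOn_comp_sub.2 hσ using 1
    ext t
    simp only [mem_Ioo, mem_ofPred_eq, neg_lt_sub_iff_lt_add, sub_lt_iff_lt_add']
  have hglue := isMIntegralCurveOn_piecewise hv hγ hσ' (t₀ := t₀)
    ⟨⟨hat₀, ht₀b⟩, sub_lt_self t₀ hε, lt_add_of_pos_right t₀ hε⟩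
    (by rw [Function.comp_apply, sub_self, hσ₀])
  refine ⟨_, t₀ + ε - b, by linarith, piecewise_eqOn .., hglue.mono fun t ht => ?_⟩
  rcases lt_or_ge t b with htb | hbt
  · exact .inl ⟨ht.1, htb⟩
  · exact .inr ⟨by linarith, by linarith [ht.2]⟩

lemma exists_isMIntegralCurveOn_Ioo_of_forall_lt [IsManifold 𝓘(ℝ, E) 1 M]
    (hv : ContMDiff 𝓘(ℝ, E) (𝓘(ℝ, E).prod 𝓘(ℝ, E)) 1
      (fun x => (⟨x, v x⟩ : TangentBundle 𝓘(ℝ, E) M))) {x : M} {c : ℝ} (hc : 0 < c)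
    (h : ∀ a < c, ∃ γ : ℝ → M, γ 0 = x ∧ IsMIntegralCurveOn γ v (Ioo (-a) a)) :
    ∃ γ : ℝ → M, γ 0 = x ∧ IsMIntegralCurveOn γ v (Ioo (-c) c) := by
  have : Nonempty M := ⟨x⟩
  choose! γ hγ₀ hγ using h
  have hagree : ∀ {a b}, 0 < a → a ≤ b → b < c → EqOn (γ a) (γ b) (Ioo (-a) a) :=
    fun {a b} ha hab hb => isMIntegralCurveOn_Ioo_eqOn_of_contMDiff_boundaryless (t₀ := 0)
      ⟨neg_lt_zero.2 ha, ha⟩ hv (hγ a (hab.trans_lt hb))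
      ((hγ b hb).mono (Ioo_subset_Ioo (neg_le_neg hab) hab))
      (by rw [hγ₀ a (hab.trans_lt hb), hγ₀ b hb])
  set r : ℝ → ℝ := fun t => (|t| + c) / 2 with hr
  have hr₀ : ∀ t, 0 < r t := fun t => by positivity
  have hrc : ∀ t ∈ Ioo (-c) c, r t < c := fun t ht => by
    simp only [hr]
    linarith [abs_lt.2 ht]
  have hrt : ∀ t ∈ Ioo (-c) c, t ∈ Ioo (-r t) (r t) := fun t ht => abs_lt.1 <| by
    simp only [hr]
    linarith [abs_lt.2 ht]
  refine ⟨fun t => γ (r t) t, hγ₀ _ (hrc 0 ⟨neg_lt_zero.2 hc, hc⟩), fun t ht =>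
    HasMFDerivAt.hasMFDerivWithinAt ?_⟩
  have ht_nhds := Ioo_mem_nhds (hrt t ht).1 (hrt t ht).2
  refine ((hγ _ (hrc t ht) t (hrt t ht)).hasMFDerivAt ht_nhds).congr_of_eventuallyEq ?_
  filter_upwards [ht_nhds, Ioo_mem_nhds ht.1 ht.2] with s hst hs
  rcases le_total (r s) (r t) with h | h
  · exact hagree (hr₀ s) h (hrc t ht) (hrt s hs)
  · exact (hagree (hr₀ t) h (hrc s hs) hst).symm

variable [Bundle.RiemannianBundle (fun x : M => TangentSpace 𝓘(ℝ, E) x)]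
  [IsManifold 𝓘(ℝ, E) ∞ M] [IsRiemannianManifold 𝓘(ℝ, E) M] [CompleteSpace E] [CompleteSpace M]

lemma exists_isMIntegralCurveOn_right_of_enorm_le
    (hv : ContMDiff 𝓘(ℝ, E) (𝓘(ℝ, E).prod 𝓘(ℝ, E)) 1
      (fun x => (⟨x, v x⟩ : TangentBundle 𝓘(ℝ, E) M)))
    {C : NNReal} (hvC : ∀ x, ‖v x‖ₑ ≤ C) {a b : ℝ} (hab : a < b)
    (hγ : IsMIntegralCurveOn γ v (Ioo a b)) :
    ∃ γ' : ℝ → M, ∃ ε > 0, EqOn γ' γ (Ioo a b) ∧ IsMIntegralCurveOn γ' v (Ioo a (b + ε)) := by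
  have : IsManifold 𝓘(ℝ, E) 1 M := inferInstance
  obtain ⟨y, hy⟩ := exists_tendsto_nhdsLT_of_lipschitzOnWith hab
    (lipschitzOnWith_of_isMIntegralCurveOn hv.continuous hvC hγ)
  exact exists_isMIntegralCurveOn_right hv hab hγ hy

lemma exists_isMIntegralCurveOn_left_of_enorm_le
    (hv : ContMDiff 𝓘(ℝ, E) (𝓘(ℝ, E).prod 𝓘(ℝ, E)) 1
      (fun x => (⟨x, v x⟩ : TangentBundle 𝓘(ℝ, E) M)))
    {C : NNReal} (hvC : ∀ x, ‖v x‖ₑ ≤ C) {a b : ℝ} (hab : a < b)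
    (hγ : IsMIntegralCurveOn γ v (Ioo a b)) :
    ∃ γ' : ℝ → M, ∃ ε > 0, EqOn γ' γ (Ioo a b) ∧ IsMIntegralCurveOn γ' v (Ioo (a - ε) b) := by
  have : IsManifold 𝓘(ℝ, E) 1 M := inferInstance
  have hneg : ContMDiff 𝓘(ℝ, E) (𝓘(ℝ, E).prod 𝓘(ℝ, E)) 1
      (fun x => (⟨x, ((-1 : ℝ) • v) x⟩ : TangentBundle 𝓘(ℝ, E) M)) :=
    ContMDiff.const_smul_section hv
  have hreflect : ∀ c d : ℝ, {t : ℝ | t * -1 ∈ Ioo c d} = Ioo (-d) (-c) := fun c d => by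
    ext t
    simp only [mem_ofPred_eq, mul_neg_one, ← neg_mem_Ioo_iff]
  obtain ⟨γ', ε, hε, heq, hγ'⟩ := exists_isMIntegralCurveOn_right_of_enorm_le hneg
    (fun x => by simpa [enorm_smul] using hvC x) (neg_lt_neg hab) (hreflect a b ▸ hγ.comp_mul (-1))
  refine ⟨γ' ∘ (· * -1), ε, hε, fun t ht => ?_, ?_⟩
  · have ht' : t * -1 ∈ Ioo (-b) (-a) := ⟨by linarith [ht.2], by linarith [ht.1]⟩
    simpa only [Function.comp_apply, mul_neg_one, neg_neg] using heq ht'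
  · have h := hγ'.comp_mul (-1)
    rwa [hreflect, neg_neg, neg_add, neg_neg, ← sub_eq_add_neg, smul_smul, neg_one_mul, neg_neg,
      one_smul] at h

lemma exists_lt_isMIntegralCurveOn_of_enorm_le
    (hv : ContMDiff 𝓘(ℝ, E) (𝓘(ℝ, E).prod 𝓘(ℝ, E)) 1
      (fun x => (⟨x, v x⟩ : TangentBundle 𝓘(ℝ, E) M)))
    {C : NNReal} (hvC : ∀ x, ‖v x‖ₑ ≤ C) {c : ℝ} (hc : 0 < c)
    (hγ : IsMIntegralCurveOn γ v (Ioo (-c) c)) :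
    ∃ d > c, ∃ γ' : ℝ → M, γ' 0 = γ 0 ∧ IsMIntegralCurveOn γ' v (Ioo (-d) d) := by
  obtain ⟨γ₁, ε₁, hε₁, heq₁, hγ₁⟩ :=
    exists_isMIntegralCurveOn_right_of_enorm_le hv hvC (by linarith) hγ
  obtain ⟨γ₂, ε₂, hε₂, heq₂, hγ₂⟩ :=
    exists_isMIntegralCurveOn_left_of_enorm_le hv hvC (by linarith) hγ₁
  refine ⟨c + min ε₁ ε₂, by linarith [lt_min hε₁ hε₂], γ₂, ?_, hγ₂.mono (Ioo_subset_Ioo ?_ ?_)⟩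
  · rw [heq₂ ⟨by linarith, by linarith⟩, heq₁ ⟨by linarith, hc⟩]
  · linarith [min_le_right ε₁ ε₂]
  · linarith [min_le_left ε₁ ε₂]

/- An integral curve of a bounded field is Lipschitz, so by completeness it converges at a finite
end of its interval of definition, and the local flow near the limit continues it. -/
theorem exists_isMIntegralCurve_of_enorm_le
    (hv : ContMDiff 𝓘(ℝ, E) (𝓘(ℝ, E).prod 𝓘(ℝ, E)) 1
      (fun x => (⟨x, v x⟩ : TangentBundle 𝓘(ℝ, E) M)))
    {C : NNReal} (hvC : ∀ x, ‖v x‖ₑ ≤ C) (x : M) :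
    ∃ γ : ℝ → M, γ 0 = x ∧ IsMIntegralCurve γ v := by
  have : IsManifold 𝓘(ℝ, E) 1 M := inferInstance
  rw [exists_isMIntegralCurve_iff_exists_isMIntegralCurveOn_Ioo hv]
  set P : Set ℝ := {a | ∃ γ : ℝ → M, γ 0 = x ∧ IsMIntegralCurveOn γ v (Ioo (-a) a)}
  have hmono : ∀ a ∈ P, ∀ b ≤ a, b ∈ P := fun a ⟨γ, hγ₀, hγ⟩ b hb =>
    ⟨γ, hγ₀, hγ.mono (Ioo_subset_Ioo (neg_le_neg hb) hb)⟩
  obtain ⟨ε, hε, hflow⟩ := exists_eventually_exists_isMIntegralCurveOn (hv x)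
  have hεP : ε ∈ P := hflow.self_of_nhds
  by_contra! ⟨a, ha⟩
  have hbdd : BddAbove P := ⟨a, fun b hb => le_of_not_ge fun hab =>
    let ⟨γ, hγ₀, hγ⟩ := hmono b hb a hab; ha γ hγ₀ hγ⟩
  have hsup : 0 < sSup P := hε.trans_le (le_csSup hbdd hεP)
  obtain ⟨γ, hγ₀, hγ⟩ := exists_isMIntegralCurveOn_Ioo_of_forall_lt hv hsup fun b hb =>
    let ⟨d, hd, hbd⟩ := exists_lt_of_lt_csSup ⟨ε, hεP⟩ hb
    hmono d hd b hbd.le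
  obtain ⟨d, hd, γ', hγ'₀, hγ'⟩ := exists_lt_isMIntegralCurveOn_of_enorm_le hv hvC hsup hγ
  exact (le_csSup hbdd ⟨γ', hγ'₀.trans hγ₀, hγ'⟩).not_gt hd

end Complete

/-! ### The contact form and its moment map -/

namespace SmoothAction

variable {F : Type*} [NormedAddCommGroup F] [NormedSpace ℝ F]
  {G : Type*} [TopologicalSpace G] [ChartedSpace F G] [Group G]
  {E : Type*} [NormedAddCommGroup E] [NormedSpace ℝ E]
  {M : Type*} [TopologicalSpace M] [ChartedSpace E M]
  {K : Type*} [NormedAddCommGroup K] [NormedSpace ℝ K]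
  {S : Type*} [TopologicalSpace S] [ChartedSpace K S]
  {A : SmoothAction F G E M} {B : SmoothAction F G K S} {q : S → M}

lemma mfderiv_act_of_equivariant (hq : MDifferentiable 𝓘(ℝ, K) 𝓘(ℝ, E) q)
    (hqB : ∀ a s, q (B.act a s) = A.act a (q s)) (a : G) (s : S) (v : TangentSpace 𝓘(ℝ, K) s) :
    (mfderiv 𝓘(ℝ, K) 𝓘(ℝ, E) q (B.act a s) (mfderiv 𝓘(ℝ, K) 𝓘(ℝ, K) (B.act a) s v) : E)
      = mfderiv 𝓘(ℝ, E) 𝓘(ℝ, E) (A.act a) (q s) (mfderiv 𝓘(ℝ, K) 𝓘(ℝ, E) q s v) := by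
  have hB := mfderiv_comp_apply s (hq (B.act a s)) (B.mdifferentiable_act a s) v
  have hA := mfderiv_comp_apply s (A.mdifferentiable_act a (q s)) (hq s) v
  rw [show q ∘ B.act a = A.act a ∘ q from funext (hqB a)] at hB
  exact hB.symm.trans hA

lemma mfderiv_fundamental_of_equivariant (hq : MDifferentiable 𝓘(ℝ, K) 𝓘(ℝ, E) q)
    (hqB : ∀ a s, q (B.act a s) = A.act a (q s)) (s : S) (X : GroupLieAlgebra 𝓘(ℝ, F) G) :
    mfderiv 𝓘(ℝ, K) 𝓘(ℝ, E) q s (B.fundamental s X) = A.fundamental (q s) X := by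
  have hB := mfderiv_comp_of_eq (x := (1 : G)) (hq s)
    ((B.contMDiff_orbit s).mdifferentiableAt (by simp)) (B.one_act s)
  rw [show q ∘ (fun a => B.act a s) = fun a => A.act a (q s) from funext fun a => hqB a s] at hB
  refine Eq.trans ?_ (DFunLike.congr_fun hB X).symm
  exact congrArg (fun t => (mfderiv 𝓘(ℝ, K) 𝓘(ℝ, E) q t : K →L[ℝ] E) (B.fundamental s X))
    (B.one_act s).symm

end SmoothAction

section Contact

variable {F : Type*} [NormedAddCommGroup F] [NormedSpace ℝ F]
  {G : Type*} [TopologicalSpace G] [ChartedSpace F G] [Group G]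
  {E : Type*} [NormedAddCommGroup E] [NormedSpace ℝ E]
  {M : Type*} [TopologicalSpace M] [ChartedSpace E M]
  {N : Type*} [TopologicalSpace N] [ChartedSpace E N]
  {K : Type*} [NormedAddCommGroup K] [NormedSpace ℝ K]
  {S : Type*} [TopologicalSpace S] [ChartedSpace K S]
  {J : EndField E M} {θ : OneForm E M} {A : SmoothAction F G E M} {B : SmoothAction F G K S}
  {p : N → M} {h : N → ℝ} {ι : S → N}

lemma mfderiv_liftEndField (J : EndField E M) {x : N}
    (hp : (mfderiv 𝓘(ℝ, E) 𝓘(ℝ, E) p x).IsInvertible) (v : TangentSpace 𝓘(ℝ, E) x) :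
    mfderiv 𝓘(ℝ, E) 𝓘(ℝ, E) p x (liftEndField J p x v)
      = J (p x) (mfderiv 𝓘(ℝ, E) 𝓘(ℝ, E) p x v) :=
  hp.self_apply_inverse _

lemma contactForm_apply (hp : IsMinimalCovering θ p h) {s : S}
    (hι : MDifferentiableAt 𝓘(ℝ, K) 𝓘(ℝ, E) ι s) (v : TangentSpace 𝓘(ℝ, K) s) :
    contactForm J p h ι s v
      = -θ (p (ι s)) (J (p (ι s)) (mfderiv 𝓘(ℝ, K) 𝓘(ℝ, E) (p ∘ ι) s v)) := by
  have hinv : (mfderiv 𝓘(ℝ, E) 𝓘(ℝ, E) p (ι s)).IsInvertible :=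
    ⟨(hp.localDiffeo (ι s)).mfderivToContinuousLinearEquiv (by simp), rfl⟩
  rw [mfderiv_comp_apply s (hp.mdifferentiable _) hι]
  refine congrArg Neg.neg ((hp.primitive _ _).trans ?_)
  exact congrArg (θ (p (ι s))) (mfderiv_liftEndField J hinv _)

lemma IsInducedAction.comp_act (hB : IsInducedAction p ι A B) (a : G) (s : S) :
    (p ∘ ι) (B.act a s) = A.act a ((p ∘ ι) s) := by
  obtain ⟨A', hpA', hιB⟩ := hB
  rw [Function.comp_apply, hιB, hpA', Function.comp_apply]

lemma IsAssociatedHypersurface.mdifferentiable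
    (hι : IsAssociatedHypersurface (E := E) (K := K) h ι) :
    MDifferentiable 𝓘(ℝ, K) 𝓘(ℝ, E) ι :=
  hι.embedding.contMDiff.mdifferentiable (by simp)

variable [IsManifold 𝓘(ℝ, E) ∞ M]
  [Bundle.RiemannianBundle (fun x : M => TangentSpace 𝓘(ℝ, E) x)]
  [IsContMDiffRiemannianBundle 𝓘(ℝ, E) ∞ E (fun x : M => TangentSpace 𝓘(ℝ, E) x)]

lemma IsInducedAction.isContact (hB : IsInducedAction p ι A B) (hM : IsLCK J θ)
    (hA : A.ByVaismanAutomorphisms J) (hp : IsMinimalCovering θ p h)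
    (hι : IsAssociatedHypersurface (E := E) (K := K) h ι) :
    B.IsContact (contactForm J p h ι) := by
  intro a s v
  have hq : MDifferentiable 𝓘(ℝ, K) 𝓘(ℝ, E) (p ∘ ι) := hp.mdifferentiable.comp hι.mdifferentiable
  set x := (p ∘ ι) s
  set w := mfderiv 𝓘(ℝ, K) 𝓘(ℝ, E) (p ∘ ι) s v
  rw [contactForm_apply hp (hι.mdifferentiable _), contactForm_apply hp (hι.mdifferentiable _),
    neg_inj]
  calc θ ((p ∘ ι) (B.act a s)) (J ((p ∘ ι) (B.act a s))
        (mfderiv 𝓘(ℝ, K) 𝓘(ℝ, E) (p ∘ ι) (B.act a s) (mfderiv 𝓘(ℝ, K) 𝓘(ℝ, K) (B.act a) s v)))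
      = θ ((p ∘ ι) (B.act a s)) (J ((p ∘ ι) (B.act a s))
          (mfderiv 𝓘(ℝ, E) 𝓘(ℝ, E) (A.act a) x w : E)) :=
        congrArg (fun u : E => θ ((p ∘ ι) (B.act a s)) (J ((p ∘ ι) (B.act a s)) u))
          (SmoothAction.mfderiv_act_of_equivariant hq hB.comp_act a s v)
    _ = θ (A.act a x) (J (A.act a x) (mfderiv 𝓘(ℝ, E) 𝓘(ℝ, E) (A.act a) x w)) :=
        congrArg (fun y => (θ y : E →L[ℝ] ℝ) ((J y : E →L[ℝ] E)
          (mfderiv 𝓘(ℝ, E) 𝓘(ℝ, E) (A.act a) x w))) (hB.comp_act a s)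
    _ = θ (A.act a x) (mfderiv 𝓘(ℝ, E) 𝓘(ℝ, E) (A.act a) x (J x w)) :=
        congrArg (θ (A.act a x)) (hA.holomorphic a x w).symm
    _ = θ x (J x w) := hA.lee_mfderiv hM a x (J x w)

lemma IsInducedAction.contactMomentMap_eq [FiniteDimensional ℝ E] [PreconnectedSpace M]
    [LieGroup 𝓘(ℝ, F) ∞ G] (hB : IsInducedAction p ι A B) (hM : IsVaisman J θ)
    (hA : A.ByVaismanAutomorphisms J) {μ : M → LieDual F G} (hμ : IsTwistedMomentMap J θ A μ)
    (hp : IsMinimalCovering θ p h)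
    (hι : IsAssociatedHypersurface (E := E) (K := K) h ι) (s : S) :
    contactMomentMap B (contactForm J p h ι) s = μ (p (ι s)) := by
  ext X
  rw [hμ.apply_eq hA hM]
  refine (contactForm_apply hp (hι.mdifferentiable s) _).trans ?_
  exact congrArg (fun w => -θ (p (ι s)) (J (p (ι s)) w))
    (SmoothAction.mfderiv_fundamental_of_equivariant (hp.mdifferentiable.comp hι.mdifferentiable)
      hB.comp_act s X)

end Contact

section Range

variable {F : Type*} [NormedAddCommGroup F] [NormedSpace ℝ F]
  {G : Type*} [TopologicalSpace G] [ChartedSpace F G] [Group G] [LieGroup 𝓘(ℝ, F) ∞ G]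
  {E : Type*} [NormedAddCommGroup E] [NormedSpace ℝ E] [FiniteDimensional ℝ E]
  {M : Type*} [MetricSpace M] [ChartedSpace E M] [IsManifold 𝓘(ℝ, E) ∞ M]
  [Bundle.RiemannianBundle (fun x : M => TangentSpace 𝓘(ℝ, E) x)]
  [IsContMDiffRiemannianBundle 𝓘(ℝ, E) ∞ E (fun x : M => TangentSpace 𝓘(ℝ, E) x)]
  {J : EndField E M} {θ : OneForm E M} {A : SmoothAction F G E M} {μ : M → LieDual F G}

lemma IsVaisman.exists_isMIntegralCurve_sharp [IsRiemannianManifold 𝓘(ℝ, E) M] [CompleteSpace M]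
    (hM : IsVaisman J θ) (x : M) : ∃ γ : ℝ → M, γ 0 = x ∧ IsMIntegralCurve γ (sharp θ) ∧
      MDifferentiable 𝓘(ℝ, ℝ) 𝓘(ℝ, E) γ := by
  have : IsManifold 𝓘(ℝ, E) 1 M := inferInstance
  have hv : ContMDiff 𝓘(ℝ, E) (𝓘(ℝ, E).prod 𝓘(ℝ, E)) 1
      (fun x => (⟨x, sharp θ x⟩ : TangentBundle 𝓘(ℝ, E) M)) := fun x =>
    ContMDiffAt.of_le (sharp_smoothAt (hM.toIsLCK.smoothAt x)) ENat.LEInfty.out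
  obtain ⟨γ, hγ₀, hγ⟩ := exists_isMIntegralCurve_of_enorm_le (C := 1) hv
    (fun x => by rw [← ofReal_norm, norm_sharp, hM.unit_length]; simp) x
  exact ⟨γ, hγ₀, hγ, fun t => (hγ t).mdifferentiableAt⟩

lemma IsTwistedMomentMap.apply_eq_of_isMIntegralCurve [PreconnectedSpace M]
    (hμ : IsTwistedMomentMap J θ A μ) (hA : A.ByVaismanAutomorphisms J) (hM : IsVaisman J θ)
    {γ : ℝ → M} (hγ : IsMIntegralCurve γ (sharp θ)) (t : ℝ) : μ (γ t) = μ (γ 0) := by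
  ext X
  have hμX : MDifferentiable 𝓘(ℝ, E) 𝓘(ℝ, ℝ) (fun y => μ y X) :=
    (hμ.smooth X).mdifferentiable (by simp)
  have hγd : MDifferentiable 𝓘(ℝ, ℝ) 𝓘(ℝ, E) γ := fun t => (hγ t).mdifferentiableAt
  have hflow : ∀ t (r : ℝ),
      mvfderiv 𝓘(ℝ, E) (fun y => μ y X) (γ t) (mfderiv 𝓘(ℝ, ℝ) 𝓘(ℝ, E) γ t r) = 0 := fun t r => by
    rw [mfderiv_of_isMIntegralCurveAt (hγ.isMIntegralCurveAt t), map_smul,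
      hμ.mvfderiv_sharp_eq_zero hA hM, smul_zero]
  exact (isLocallyConstant_of_mvfderiv_eq_zero (hμX.comp hγd) fun t =>
    (mvfderiv_comp_mfderiv (hμX _) (hγd t)).trans
      (ContinuousLinearMap.ext (hflow t))).apply_eq_of_preconnectedSpace t 0

lemma IsTwistedMomentMap.exists_eq_of_primitive_eq_zero [IsRiemannianManifold 𝓘(ℝ, E) M]
    [PreconnectedSpace M] [CompleteSpace M] {N : Type*} [TopologicalSpace N] [ChartedSpace E N]
    [IsManifold 𝓘(ℝ, E) 1 N] {p : N → M} {h : N → ℝ} (hμ : IsTwistedMomentMap J θ A μ)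
    (hA : A.ByVaismanAutomorphisms J) (hM : IsVaisman J θ) (hp : IsMinimalCovering θ p h) (m : M) :
    ∃ n, h n = 0 ∧ μ (p n) = μ m := by
  obtain ⟨γ, rfl, hγ, hγd⟩ := hM.exists_isMIntegralCurve_sharp m
  obtain ⟨n₀, hn₀⟩ := hp.surjective (γ 0)
  have hθγ : ∀ t (r : ℝ), θ (γ t) (mfderiv 𝓘(ℝ, ℝ) 𝓘(ℝ, E) γ t r) = mvfderiv 𝓘(ℝ, ℝ) id t r :=
    fun t r => by
      rw [mfderiv_of_isMIntegralCurveAt (hγ.isMIntegralCurveAt t), map_smul, hM.lee_sharp,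
        smul_eq_mul, mul_one]
      exact (DFunLike.congr_fun mfderiv_id r).symm
  obtain ⟨n, hn, hhn⟩ := hp.exists_lift_point hγd mdifferentiable_id hθγ hn₀ (-h n₀)
  exact ⟨n, by simpa using hhn, by rw [hn, hμ.apply_eq_of_isMIntegralCurve hA hM hγ]⟩

end Range

end VaismanMoment

theorem proposition6p1
    -- a complete connected Vaisman manifold `M`
    {E : Type*} [NormedAddCommGroup E] [NormedSpace ℝ E] [FiniteDimensional ℝ E]
    {M : Type*} [MetricSpace M] [ChartedSpace E M] [IsManifold 𝓘(ℝ, E) ∞ M]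
    [Bundle.RiemannianBundle (fun x : M => TangentSpace 𝓘(ℝ, E) x)]
    [IsContMDiffRiemannianBundle 𝓘(ℝ, E) ∞ E (fun x : M => TangentSpace 𝓘(ℝ, E) x)]
    [IsRiemannianManifold 𝓘(ℝ, E) M] [ConnectedSpace M] [CompleteSpace M]
    (J : VaismanMoment.EndField E M) (θ : VaismanMoment.OneForm E M)
    (hM : VaismanMoment.IsVaisman J θ)
    -- a compact connected Lie group `G`
    {F : Type*} [NormedAddCommGroup F] [NormedSpace ℝ F] [FiniteDimensional ℝ F]
    {G : Type*} [TopologicalSpace G] [T2Space G] [ChartedSpace F G] [Group G]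
    [LieGroup 𝓘(ℝ, F) ∞ G] [CompactSpace G] [ConnectedSpace G]
    -- a twisted Hamiltonian action by Vaisman automorphisms, with its twisted moment map
    (A : VaismanMoment.SmoothAction F G E M) (hA : A.ByVaismanAutomorphisms J)
    (μ : M → VaismanMoment.LieDual F G) (hμ : VaismanMoment.IsTwistedMomentMap J θ A μ)
    -- the minimal covering of `M`
    {N : Type*} [TopologicalSpace N] [ChartedSpace E N] [IsManifold 𝓘(ℝ, E) ∞ N]
    (p : N → M) (h : N → ℝ) (hp : VaismanMoment.IsMinimalCovering θ p h)
    -- the associated Sasakian manifold, as a hypersurface of the minimal covering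
    {K : Type*} [NormedAddCommGroup K] [NormedSpace ℝ K] [FiniteDimensional ℝ K]
    {S : Type*} [TopologicalSpace S] [ChartedSpace K S] [IsManifold 𝓘(ℝ, K) ∞ S]
    (ι : S → N) (hι : VaismanMoment.IsAssociatedHypersurface (E := E) (K := K) h ι) :
    (∃ B : VaismanMoment.SmoothAction F G K S, VaismanMoment.IsInducedAction p ι A B) ∧
    ∀ B : VaismanMoment.SmoothAction F G K S, VaismanMoment.IsInducedAction p ι A B →
      B.IsContact (VaismanMoment.contactForm J p h ι) ∧
      Set.range (VaismanMoment.contactMomentMap B (VaismanMoment.contactForm J p h ι))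
        = Set.range μ := by
  have hL := hM.toIsLCK
  refine ⟨?_, fun B hB => ⟨hB.isContact hL hA hp hι, ?_⟩⟩
  · obtain ⟨A', hpA', hhA'⟩ := hp.exists_lift_action (hA.lee_mfderiv hL)
      (hμ.lee_fundamental_eq_zero hA hL)
    obtain ⟨B, hB⟩ := hι.exists_restrict A' hhA'
    exact ⟨B, A', hpA', hB⟩
  · have hΦ := hB.contactMomentMap_eq hM hA hμ hp hι
    refine Set.Subset.antisymm ?_ ?_
    · rintro _ ⟨s, rfl⟩
      exact ⟨p (ι s), (hΦ s).symm⟩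
    · rintro _ ⟨m, rfl⟩
      obtain ⟨n, hn, hμn⟩ := hμ.exists_eq_of_primitive_eq_zero hA hM hp m
      obtain ⟨s, rfl⟩ := hι.range_eq.ge hn
      exact ⟨s, (hΦ s).trans hμn⟩
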